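/- Let $m\ge 2$, $n\ge 1$, let $\mathcal G$ be a connected undirected graph on $\{1,\dots,m\}$ with Laplacian matrix $\mathbf L\in\mathbb R^{m\times m}$, let $\sqrt{\mathbf L}$ be its symmetric positive semidefinite square root, and $\sqrt{\hat{\mathbf L}}=\sqrt{\mathbf L}\otimes\mathbf I_n$. Let $f_1,\dots,f_m:\mathbb R^n\to\mathbb R$ be twice continuously differentiable and coercive, with $f_i$ having an $L^g_{f_i}$-Lipschitz gradient and an $L^H_{f_i}$-Lipschitz Hessian (in spectral norm), and let $f_i^\star$ be the global minimum of $f_i$. Put $F(\boldsymbol\theta)=\sum_{i=1}^m f_i(\boldsymbol\theta_i)$ for $\boldsymbol\theta\in(\mathbb R^n)^m$, $\Psi_{\boldsymbol\theta^0}(\mathbf x)=F(\boldsymbol\theta^0+\sqrt{\hat{\mathbf L}}\,\mathbf x)$, $L^g_\Psi=\|\sqrt{\mathbf L}\|^2\max_i L^g_{f_i}$ and $L^H_\Psi=\|\sqrt{\mathbf L}\|^3\max_i L^H_{f_i}$. Let $\mathbf r\in\mathbb R^n$, $\epsilon_g>0$, $\epsilon_H=\sqrt{\epsilon_g L^H_\Psi}$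 and $0<p<1$. Then there exists $\bar\alpha$ with $$0<\bar\alpha\le\min\Big\{\frac1{L^g_\Psi},\,-\frac{2\ln p}{L^g_\Psi}\Big\}$$ such that the following holds for every step size $0<\alpha\le\bar\alpha$ and every $\boldsymbol\theta^0\in(\mathbb R^n)^m$ with $\sum_{i=1}^m\boldsymbol\theta^0_i=\mathbf r$ and $F(\boldsymbol\theta^0)>\sum_{i=1}^m f_i^\star$. Let $\mathbf n_i^k$ ($k\ge0$, $1\le i\le m$) be independent random vectors in $\mathbb R^n$, each with law $\mathcal N(\mathbf 0,\sigma^2\mathbf I_n)$, where $\sigma^2=\frac{\epsilon_g^2}{12mn}$, let $\mathbf n^k=(\mathbf n^k_1,\dots,\mathbf n^k_m)$, and let $$\mathbf x^0=\mathbf 0,\qquad \mathbf x^{k+1}=\mathbf x^k-\alpha\big(\nabla\Psi_{\boldsymbol\theta^0}(\mathbf x^k)+\mathbf n^k\big).$$ With $$K=\Big\lceil\frac{\Psi_{\boldsymbol\theta^0}(\mathbf x^0)-\sum_{i=1}^m f_i^\star}{L^g_\Psi\,\epsilon_g^2\,\alpha^2}\Big\rceil,$$ it holds that $$\mathbb P\Big[\exists\,k\in(0,K]:\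 \|\nabla\Psi_{\boldsymbol\theta^0}(\mathbf x^k)\|\le\epsilon_g\ \text{ and }\ \lambda_{\min}\big(\nabla^2\Psi_{\boldsymbol\theta^0}(\mathbf x^k)\big)\ge-\epsilon_H\Big]\ge1-p.$$ -/

import Mathlib

open MeasureTheory ProbabilityTheory Filter
open scoped NNReal

namespace NLGD

/-- The space `(ℝⁿ)ᵐ` of block vectors with its Euclidean norm and inner product. -/
abbrev Blocks (m n : ℕ) : Type := PiLp 2 (fun _ : Fin m => EuclideanSpace ℝ (Fin n))

/-- The Hessian `∇²f(x)`, as the derivative of the gradient (a continuous linear operator);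
its operator norm is the spectral norm. -/
noncomputable def hessian {E : Type*} [NormedAddCommGroup E] [InnerProductSpace ℝ E]
    [CompleteSpace E] (f : E → ℝ) (x : E) : E →L[ℝ] E :=
  fderiv ℝ (gradient f) x

/-- The minimum eigenvalue of an operator (used for symmetric operators in finite positive
dimension, where the set of eigenvalues is finite and nonempty). -/
noncomputable def lambdaMin {E : Type*} [NormedAddCommGroup E] [InnerProductSpace ℝ E]
    (T : E →L[ℝ] E) : ℝ :=
  sInf {μ : ℝ | Module.End.HasEigenvalue (T : E →ₗ[ℝ] E) μ}

/-- The separable objective `F(θ) = ∑ᵢ fᵢ(θᵢ)`. -/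
noncomputable def objective {m n : ℕ} (f : Fin m → EuclideanSpace ℝ (Fin n) → ℝ)
    (θ : Blocks m n) : ℝ :=
  ∑ i, f i (θ i)

open scoped MatrixOrder in
/-- The positive semidefinite square root `√𝐋` of the graph Laplacian `𝐋`. -/
noncomputable def lapSqrt {m : ℕ} (G : SimpleGraph (Fin m)) [DecidableRel G.Adj] :
    Matrix (Fin m) (Fin m) ℝ :=
  CFC.sqrt (G.lapMatrix ℝ)

open scoped MatrixOrder in
theorem lapSqrt_posSemidef {m : ℕ} (G : SimpleGraph (Fin m)) [DecidableRel G.Adj] :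
    (lapSqrt G).PosSemidef :=
  Matrix.nonneg_iff_posSemidef.mp (CFC.sqrt_nonneg (G.lapMatrix ℝ))

open scoped MatrixOrder in
theorem lapSqrt_mul_self {m : ℕ} (G : SimpleGraph (Fin m)) [DecidableRel G.Adj] :
    lapSqrt G * lapSqrt G = G.lapMatrix ℝ :=
  CFC.sqrt_mul_sqrt_self (G.lapMatrix ℝ) (Matrix.nonneg_iff_posSemidef.mpr (G.posSemidef_lapMatrix ℝ))

/-- The spectral norm of a real square matrix. -/
noncomputable def specNorm {m : ℕ} (A : Matrix (Fin m) (Fin m) ℝ) : ℝ :=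
  ‖Matrix.toEuclideanCLM (n := Fin m) (𝕜 := ℝ) A‖

/-- The action of `A ⊗ Iₙ` on `(ℝⁿ)ᵐ`: the `i`-th block of the image is `∑ⱼ aᵢⱼ xⱼ`. -/
noncomputable def kronAct {m n : ℕ} (A : Matrix (Fin m) (Fin m) ℝ) (x : Blocks m n) :
    Blocks m n :=
  WithLp.toLp 2 (fun i => ∑ j, A i j • x j)

/-- The auxiliary function `Ψ(x) = F(θ⁰ + (√𝐋 ⊗ Iₙ) x)`. -/
noncomputable def auxFun {m n : ℕ} (f : Fin m → EuclideanSpace ℝ (Fin n) → ℝ)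
    (G : SimpleGraph (Fin m)) [DecidableRel G.Adj] (θ₀ : Blocks m n) (x : Blocks m n) : ℝ :=
  objective f (θ₀ + kronAct (lapSqrt G) x)

/-- The gradient-Lipschitz constant `‖√𝐋‖² maxᵢ Lgᵢ` of the auxiliary function. -/
noncomputable def auxGradLip {m : ℕ} (G : SimpleGraph (Fin m)) [DecidableRel G.Adj]
    (Lg : Fin m → ℝ≥0) : ℝ :=
  specNorm (lapSqrt G) ^ 2 * (Finset.univ.sup Lg : ℝ≥0)

/-- The Hessian-Lipschitz constant `‖√𝐋‖³ maxᵢ LHᵢ` of the auxiliary function. -/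
noncomputable def auxHessLip {m : ℕ} (G : SimpleGraph (Fin m)) [DecidableRel G.Adj]
    (LH : Fin m → ℝ≥0) : ℝ :=
  specNorm (lapSqrt G) ^ 3 * (Finset.univ.sup LH : ℝ≥0)

/-- Noisy gradient descent on `Ψ` from the origin, driven by per-agent perturbations `ν k i`:
`x⁰ = 0` and `xᵏ⁺¹ = xᵏ - α (∇Ψ(xᵏ) + νᵏ)` with `νᵏ = (ν k 1, …, ν k m)`. -/
noncomputable def noisyGD {m n : ℕ} (Ψ : Blocks m n → ℝ) (α : ℝ)
    (ν : ℕ → Fin m → EuclideanSpace ℝ (Fin n)) : ℕ → Blocks m n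
  | 0 => 0
  | k + 1 => noisyGD Ψ α ν k - α • (gradient Ψ (noisyGD Ψ α ν k) + WithLp.toLp 2 (ν k))

/-- The number of iterations `K = ⌈(Ψ(0) - ∑ᵢ fᵢ⋆) / (L ε² α²)⌉`, where `fᵢ⋆` is the global
minimum of `fᵢ`. -/
noncomputable def numIter {m n : ℕ} (f : Fin m → EuclideanSpace ℝ (Fin n) → ℝ)
    (Ψ : Blocks m n → ℝ) (L ε α : ℝ) : ℕ :=
  ⌈(Ψ 0 - ∑ i, ⨅ θ, f i θ) / (L * ε ^ 2 * α ^ 2)⌉₊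

end NLGD

open NLGD

/-! The expected value of `Ψ` falls by at least `c * α ^ 2` per iteration, over a suitable finite
horizon, from every point outside the set `S` of approximate second-order points, and `c` can be
prescribed before `α` is made small. Since `Ψ` is bounded below by `b`, a stopping argument
(`IsSmoothObjective.mul_survival_le`) bounds `c * α ^ 2 * K` times the probability of avoiding `S`
by `Ψ x - b`. With `c` of order `1 / p`, the given number of iterations makes that probability at
most `p`.

If `‖∇Ψ‖ ^ 2` exceeds a large multiple of `α`, one step suffices. Otherwise the gradient is below
`εg`, so a point outside `S` has a direction `v` of negative curvature, and `exists_escape_stepSize`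
applies with a horizon of about `τ / α` steps. The component of the gradient along `v` follows an
expanding linear recursion with fresh Gaussian noise, so its variance reaches order `α * τ`. The
descent inequality turns this into a decrease of order `α ^ 2 * τ` per step, which beats the `α ^ 2`
cost of the noise once `τ` is large. Only linear growth of the variance is used, not exponential
escape.

The linearisation error is quadratic in the displacement, whose second moment is `O(α)` over the
horizon. Characteristic functions (`norm_integral_exp_iterLaw_le`, `le_integral_norm_sq_field`) make
the error enter to first order, so second moments suffice. At frequency of order `α ^ (-1/2)` its
contribution is `O(√α)`. -/

set_option linter.unusedSectionVars false

namespace NLGD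

/-! ### Isotropic Gaussian noise and the law of the iterates -/

section NoisyDescent

variable {E : Type*} [NormedAddCommGroup E] [InnerProductSpace ℝ E] [FiniteDimensional ℝ E]
  [MeasurableSpace E] [BorelSpace E]

variable (E) in
/-- The centred isotropic Gaussian measure with standard deviation `s`. -/
noncomputable def isoGaussian (s : ℝ) : Measure E :=
  (stdGaussian E).map (fun z => s • z)

instance isGaussian_isoGaussian (s : ℝ) : IsGaussian (isoGaussian E s) := by
  have : isoGaussian E s = (stdGaussian E).map (s • ContinuousLinearMap.id ℝ E) := rfl
  rw [this]
  infer_instance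

theorem charFun_isoGaussian (s : ℝ) (t : E) :
    charFun (isoGaussian E s) t = Complex.exp (-(s ^ 2 * ‖t‖ ^ 2 / 2 : ℝ)) := by
  rw [isoGaussian, charFun_map_smul, charFun_stdGaussian, norm_smul]
  congr 1
  rw [← Complex.ofReal_pow, mul_pow, Real.norm_eq_abs, sq_abs]
  push_cast
  ring

theorem integral_isoGaussian (s : ℝ) : ∫ z, z ∂(isoGaussian E s) = 0 := by
  rw [isoGaussian, integral_map (by fun_prop) (by fun_prop), integral_smul]
  simp

theorem integral_inner_isoGaussian (s : ℝ) (a : E) :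
    ∫ z, inner ℝ a z ∂(isoGaussian E s) = 0 := by
  have h : Integrable (fun z : E => z) (isoGaussian E s) := IsGaussian.integrable_id
  rw [integral_inner h a, integral_isoGaussian, inner_zero_right]

variable (E) in
/-- The second moment of `isoGaussian E s`. -/
noncomputable def noiseMoment (s : ℝ) : ℝ := ∫ z, ‖z‖ ^ 2 ∂(isoGaussian E s)

theorem noiseMoment_nonneg (s : ℝ) : 0 ≤ noiseMoment E s :=
  integral_nonneg fun _ => by positivity

theorem memLp_isoGaussian (s : ℝ) : MemLp (fun z : E => z) 2 (isoGaussian E s) :=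
  IsGaussian.memLp_two_id

theorem integrable_sq_isoGaussian (s : ℝ) :
    Integrable (fun z : E => ‖z‖ ^ 2) (isoGaussian E s) :=
  (memLp_isoGaussian s).integrable_norm_pow (p := 2) two_ne_zero

theorem integral_norm_add_sq_isoGaussian (s : ℝ) (a : E) (c : ℝ) :
    ∫ z, ‖a + c • z‖ ^ 2 ∂(isoGaussian E s) = ‖a‖ ^ 2 + c ^ 2 * noiseMoment E s := by
  have h1 : Integrable (fun z : E => z) (isoGaussian E s) := IsGaussian.integrable_id
  have h2 := integrable_sq_isoGaussian (E := E) s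
  have h3 : Integrable (fun z : E => inner ℝ a z) (isoGaussian E s) := h1.const_inner a
  have e : ∀ z : E, ‖a + c • z‖ ^ 2 = (‖a‖ ^ 2 + 2 * c * inner ℝ a z) + c ^ 2 * ‖z‖ ^ 2 := by
    intro z
    rw [norm_add_sq_real, inner_smul_right, norm_smul, mul_pow, Real.norm_eq_abs, sq_abs]
    ring
  simp_rw [e]
  have h4 : Integrable (fun z : E => 2 * c * inner ℝ a z) (isoGaussian E s) := h3.const_mul _
  have h5 : Integrable (fun z : E => ‖a‖ ^ 2 + 2 * c * inner ℝ a z) (isoGaussian E s) :=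
    (integrable_const _).add h4
  rw [integral_add h5 (h2.const_mul _), integral_add (integrable_const _) h4, integral_const_mul, integral_const_mul,
    integral_inner_isoGaussian, noiseMoment]
  simp

theorem integrable_of_norm_le_quadratic {F : Type*} [NormedAddCommGroup F] {m : Measure E}
    [IsFiniteMeasure m] (hm : MemLp (fun w : E => w) 2 m) {φ : E → F}
    (hφ : AEStronglyMeasurable φ m) {a b : ℝ} (h : ∀ w, ‖φ w‖ ≤ a + b * ‖w‖ ^ 2) :
    Integrable φ m :=
  ((integrable_const a).add ((hm.integrable_norm_pow (p := 2) two_ne_zero).const_mul b)).mono' hφ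
    (Eventually.of_forall h)

/-- One step of gradient descent with the gradient field `D`, step size `α` and perturbation `z`. -/
def noisyStep (D : E → E) (α : ℝ) (w z : E) : E := w - α • (D w + z)

/-- The law after one step of noisy gradient descent started from the law `m`. -/
noncomputable def stepLaw (D : E → E) (α s : ℝ) (m : Measure E) : Measure E :=
  (m.prod (isoGaussian E s)).map (fun q => noisyStep D α q.1 q.2)

variable {D : E → E} {α s : ℝ}

theorem continuous_noisyStep (hD : Continuous D) :
    Continuous (fun q : E × E => noisyStep D α q.1 q.2) := by
  unfold noisyStep
  fun_prop

theorem measurable_noisyStep (hD : Continuous D) :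
    Measurable (fun q : E × E => noisyStep D α q.1 q.2) :=
  (continuous_noisyStep hD).measurable

theorem isProbabilityMeasure_stepLaw (hD : Continuous D) (m : Measure E) [IsProbabilityMeasure m] :
    IsProbabilityMeasure (stepLaw D α s m) :=
  Measure.isProbabilityMeasure_map (measurable_noisyStep hD).aemeasurable

theorem memLp_stepLaw {L : ℝ≥0} (hD : LipschitzWith L D) {m : Measure E} [IsProbabilityMeasure m]
    (hm : MemLp (fun w : E => w) 2 m) : MemLp (fun w : E => w) 2 (stepLaw D α s m) := by
  rw [stepLaw, memLp_map_measure_iff (by fun_prop)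
    (measurable_noisyStep hD.continuous).aemeasurable]
  have h1 : MemLp (fun q : E × E => q.1) 2 (m.prod (isoGaussian E s)) := hm.comp_fst _
  have h2 : MemLp (fun q : E × E => q.2) 2 (m.prod (isoGaussian E s)) :=
    (memLp_isoGaussian s).comp_snd _
  have h3 : MemLp (fun q : E × E => D q.1) 2 (m.prod (isoGaussian E s)) := by
    have hl : LipschitzWith L (fun w => D w - D 0) := fun x y => by
      simpa [edist_sub_right] using hD x y
    have := (hl.comp_memLp (by simp) h1).add (memLp_const (D 0))
    simpa [Function.comp_def, Pi.add_def] using this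
  exact h1.sub ((h3.add h2).const_smul α)

theorem memLp_noisyStep (D : E → E) (α s : ℝ) (w : E) :
    MemLp (fun z => noisyStep D α w z) 2 (isoGaussian E s) :=
  (memLp_const w).sub (((memLp_const (D w)).add (memLp_isoGaussian s)).const_smul α)

theorem integrable_comp_noisyStep {F : Type*} [NormedAddCommGroup F] (w : E) {φ : E → F}
    (hφ : Continuous φ) {a b : ℝ} (h : ∀ w, ‖φ w‖ ≤ a + b * ‖w‖ ^ 2) :
    Integrable (fun z => φ (noisyStep D α w z)) (isoGaussian E s) := by
  have hc : Continuous (fun z => noisyStep D α w z) := by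
    unfold noisyStep
    fun_prop
  refine ((integrable_const a).add (((memLp_noisyStep D α s w).integrable_norm_pow
    (p := 2) two_ne_zero).const_mul b)).mono' (hφ.comp hc).aestronglyMeasurable
    (Eventually.of_forall fun z => h _)

theorem integral_stepLaw {F : Type*} [NormedAddCommGroup F] [NormedSpace ℝ F]
    (hD : Continuous D) {m : Measure E} [IsProbabilityMeasure m] {φ : E → F}
    (hφ : Integrable φ (stepLaw D α s m)) :
    ∫ w, φ w ∂(stepLaw D α s m) = ∫ w, ∫ z, φ (noisyStep D α w z) ∂(isoGaussian E s) ∂m := by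
  have hm := (measurable_noisyStep (α := α) hD).aemeasurable (μ := m.prod (isoGaussian E s))
  have h1 := hφ.aestronglyMeasurable
  unfold stepLaw at hφ h1 ⊢
  rw [integral_map hm h1, integral_prod]
  exact (integrable_map_measure h1 hm).1 hφ

theorem integrable_integral_stepLaw {F : Type*} [NormedAddCommGroup F] [NormedSpace ℝ F]
    (hD : Continuous D) {m : Measure E} [IsProbabilityMeasure m] {φ : E → F}
    (hφ : Integrable φ (stepLaw D α s m)) :
    Integrable (fun w => ∫ z, φ (noisyStep D α w z) ∂(isoGaussian E s)) m := by
  have hm := (measurable_noisyStep (α := α) hD).aemeasurable (μ := m.prod (isoGaussian E s))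
  have h1 := hφ.aestronglyMeasurable
  unfold stepLaw at hφ h1
  exact ((integrable_map_measure h1 hm).1 hφ).integral_prod_left

/-- The law of the `t`-th iterate of noisy gradient descent started at `x`. -/
noncomputable def iterLaw (D : E → E) (α s : ℝ) (x : E) (t : ℕ) : Measure E :=
  (stepLaw D α s)^[t] (Measure.dirac x)

theorem iterLaw_succ (D : E → E) (α s : ℝ) (x : E) (t : ℕ) :
    iterLaw D α s x (t + 1) = stepLaw D α s (iterLaw D α s x t) :=
  Function.iterate_succ_apply' _ _ _

theorem iterLaw_zero (D : E → E) (α s : ℝ) (x : E) : iterLaw D α s x 0 = Measure.dirac x := rfl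

theorem isProbabilityMeasure_iterLaw (hD : Continuous D) (x : E) (t : ℕ) :
    IsProbabilityMeasure (iterLaw D α s x t) := by
  induction t with
  | zero => rw [iterLaw_zero]; infer_instance
  | succ t ih =>
    rw [iterLaw_succ]
    exact isProbabilityMeasure_stepLaw hD _

theorem memLp_iterLaw {L : ℝ≥0} (hD : LipschitzWith L D) (x : E) (t : ℕ) :
    MemLp (fun w : E => w) 2 (iterLaw D α s x t) := by
  induction t with
  | zero =>
    rw [iterLaw_zero]
    refine (memLp_const x).ae_eq ?_
    rw [EventuallyEq, ae_dirac_eq]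
    rfl
  | succ t ih =>
    rw [iterLaw_succ]
    have := isProbabilityMeasure_iterLaw (α := α) (s := s) hD.continuous x t
    exact memLp_stepLaw hD ih

end NoisyDescent

/-! ### Descent in expectation and second moments of the displacement -/

section NoisyDescent

variable {E : Type*} [NormedAddCommGroup E] [InnerProductSpace ℝ E] [FiniteDimensional ℝ E]
  [MeasurableSpace E] [BorelSpace E]

/-- `Ψ` is continuous and bounded below by `b`, and `D` is an `L`-Lipschitz field for which `Ψ`
satisfies the descent inequality. -/
structure IsSmoothObjective (Ψ : E → ℝ) (D : E → E) (L : ℝ≥0) (b : ℝ) : Prop where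
  continuous : Continuous Ψ
  lipschitz : LipschitzWith L D
  lower : ∀ x, b ≤ Ψ x
  descent : ∀ x y, Ψ y ≤ Ψ x + inner ℝ (D x) (y - x) + L * ‖y - x‖ ^ 2

variable {Ψ : E → ℝ} {D : E → E} {L : ℝ≥0} {b α s : ℝ}

/-- The descent inequality based at `0` bounds `Ψ` above by a quadratic, and `b` bounds it below.
Hence `Ψ` is integrable for every finite measure with second moments. -/
theorem IsSmoothObjective.exists_norm_le (h : IsSmoothObjective Ψ D L b) :
    ∃ a c : ℝ, ∀ w, ‖Ψ w‖ ≤ a + c * ‖w‖ ^ 2 := by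
  refine ⟨|b| + |Ψ 0| + ‖D 0‖ ^ 2, L + 1, fun w => ?_⟩
  have h1 := h.descent 0 w
  have h2 := real_inner_le_norm (D 0) (w - 0)
  rw [sub_zero] at h1 h2
  have h3 := h.lower w
  have hL : 0 ≤ (L : ℝ) * ‖w‖ ^ 2 := by positivity
  rw [Real.norm_eq_abs, abs_le]
  constructor
  · nlinarith [neg_abs_le b, abs_nonneg (Ψ 0), sq_nonneg ‖D 0‖, sq_nonneg ‖w‖]
  · nlinarith [abs_nonneg b, le_abs_self (Ψ 0), sq_nonneg (‖D 0‖ - ‖w‖), sq_nonneg ‖D 0‖,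
      sq_nonneg ‖w‖]

theorem IsSmoothObjective.integrable (h : IsSmoothObjective Ψ D L b) {m : Measure E}
    [IsFiniteMeasure m] (hm : MemLp (fun w : E => w) 2 m) : Integrable Ψ m := by
  obtain ⟨a, c, hac⟩ := h.exists_norm_le
  exact integrable_of_norm_le_quadratic hm h.continuous.aestronglyMeasurable hac

theorem IsSmoothObjective.integrable_comp_noisyStep (h : IsSmoothObjective Ψ D L b) (w : E) :
    Integrable (fun z => Ψ (noisyStep D α w z)) (isoGaussian E s) := by
  obtain ⟨a, c, hac⟩ := h.exists_norm_le
  exact NLGD.integrable_comp_noisyStep w h.continuous hac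

theorem norm_sub_sq_le_quadratic (x w : E) : ‖‖w - x‖ ^ 2‖ ≤ 2 * ‖x‖ ^ 2 + 2 * ‖w‖ ^ 2 := by
  rw [Real.norm_of_nonneg (by positivity)]
  have := norm_sub_le w x
  nlinarith [norm_nonneg (w - x), norm_nonneg w, norm_nonneg x, sq_nonneg (‖w‖ - ‖x‖)]

theorem integrable_norm_sub_sq {m : Measure E} [IsFiniteMeasure m]
    (hm : MemLp (fun w : E => w) 2 m) (x : E) : Integrable (fun w => ‖w - x‖ ^ 2) m :=
  integrable_of_norm_le_quadratic hm (by fun_prop) (norm_sub_sq_le_quadratic x)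

theorem norm_sq_le_of_lipschitz (hD : LipschitzWith L D) (x w : E) :
    ‖D w‖ ^ 2 ≤ 2 * ‖D x‖ ^ 2 + 2 * (L : ℝ) ^ 2 * ‖w - x‖ ^ 2 := by
  have h1 : ‖D w‖ ≤ ‖D x‖ + ‖D w - D x‖ := by
    simpa using norm_add_le (D x) (D w - D x)
  have h2 : ‖D w - D x‖ ≤ L * ‖w - x‖ := by
    simpa [dist_eq_norm] using hD.dist_le_mul w x
  have h3 : 0 ≤ (L : ℝ) * ‖w - x‖ := by positivity
  nlinarith [norm_nonneg (D w), norm_nonneg (D x), sq_nonneg (‖D x‖ - L * ‖w - x‖)]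

theorem integrable_norm_sq_field (hD : LipschitzWith L D) {m : Measure E} [IsFiniteMeasure m]
    (hm : MemLp (fun w : E => w) 2 m) : Integrable (fun w => ‖D w‖ ^ 2) m := by
  have hc := hD.continuous
  refine integrable_of_norm_le_quadratic hm (by fun_prop) (a := 2 * ‖D 0‖ ^ 2)
    (b := 2 * (L : ℝ) ^ 2) fun w => ?_
  rw [Real.norm_of_nonneg (by positivity)]
  simpa using norm_sq_le_of_lipschitz hD 0 w

/-- The term linear in the noise has mean zero, and `α * L ≤ 1 / 2` lets half of the gain `α * ‖D w‖
^ 2` absorb the second-order term. What remains of the noise costs order `α ^ 2`. -/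
theorem IsSmoothObjective.integral_noisyStep_le (h : IsSmoothObjective Ψ D L b) (hα : 0 < α)
    (hαL : α * L ≤ 1 / 2) (w : E) :
    ∫ z, Ψ (noisyStep D α w z) ∂(isoGaussian E s)
      ≤ Ψ w - α / 2 * ‖D w‖ ^ 2 + L * α ^ 2 * noiseMoment E s := by
  have hi : Integrable (fun z : E => inner ℝ (D w) z) (isoGaussian E s) :=
    IsGaussian.integrable_id.const_inner _
  have hq : Integrable (fun z : E => ‖D w + (1 : ℝ) • z‖ ^ 2) (isoGaussian E s) := by
    have h1 := ((memLp_const (D w)).add (memLp_isoGaussian (E := E) s)).integrable_norm_pow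
      (p := 2) two_ne_zero
    simpa using h1
  have hi1 : Integrable (fun z : E => Ψ w - α * ‖D w‖ ^ 2 - α * inner ℝ (D w) z)
      (isoGaussian E s) := (integrable_const _).sub (hi.const_mul _)
  have hi2 : Integrable (fun z : E => L * α ^ 2 * ‖D w + (1 : ℝ) • z‖ ^ 2) (isoGaussian E s) :=
    hq.const_mul _
  have key : ∀ z, Ψ (noisyStep D α w z) ≤ (Ψ w - α * ‖D w‖ ^ 2 - α * inner ℝ (D w) z)
      + L * α ^ 2 * ‖D w + (1 : ℝ) • z‖ ^ 2 := by
    intro z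
    refine (h.descent w _).trans (le_of_eq ?_)
    have e : noisyStep D α w z - w = -(α • (D w + z)) := by
      unfold noisyStep
      abel
    rw [e, inner_neg_right, inner_smul_right, inner_add_right, real_inner_self_eq_norm_sq,
      norm_neg, norm_smul, mul_pow, Real.norm_eq_abs, sq_abs, one_smul]
    ring
  refine (integral_mono (h.integrable_comp_noisyStep w) (hi1.add hi2) key).trans ?_
  simp only [Pi.add_apply]
  rw [integral_add hi1 hi2, integral_sub (integrable_const _) (hi.const_mul _),
    integral_const_mul, integral_const_mul, integral_inner_isoGaussian,
    integral_norm_add_sq_isoGaussian]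
  simp only [integral_const, probReal_univ, smul_eq_mul]
  nlinarith [mul_nonneg hα.le (sq_nonneg ‖D w‖), mul_le_mul_of_nonneg_right hαL
    (mul_nonneg hα.le (sq_nonneg ‖D w‖))]

theorem IsSmoothObjective.integral_stepLaw_le (h : IsSmoothObjective Ψ D L b) (hα : 0 < α)
    (hαL : α * L ≤ 1 / 2) {m : Measure E} [IsProbabilityMeasure m]
    (hm : MemLp (fun w : E => w) 2 m) :
    ∫ w, Ψ w ∂(stepLaw D α s m)
      ≤ ∫ w, Ψ w ∂m - α / 2 * ∫ w, ‖D w‖ ^ 2 ∂m + L * α ^ 2 * noiseMoment E s := by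
  have hD := h.lipschitz.continuous
  have := isProbabilityMeasure_stepLaw (α := α) (s := s) hD m
  have hΨ := h.integrable (memLp_stepLaw (α := α) (s := s) h.lipschitz hm)
  have hd := (integrable_norm_sq_field h.lipschitz hm).const_mul (α / 2)
  rw [integral_stepLaw hD hΨ, ← integral_const_mul]
  have hi : Integrable (fun w => Ψ w - α / 2 * ‖D w‖ ^ 2) m := (h.integrable hm).sub hd
  refine (integral_mono (integrable_integral_stepLaw hD hΨ) (hi.add (integrable_const _))
    fun w => h.integral_noisyStep_le hα hαL w).trans (le_of_eq ?_)
  simp only [Pi.add_apply]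
  rw [integral_add hi (integrable_const _), integral_sub (h.integrable hm) hd]
  simp

/-- Centred noise adds only `α ^ 2` times its second moment. When `‖D x‖ ^ 2 = O(α)` the whole
additive term is `O(α ^ 2)`, so `O(1 / α)` steps displace by `O(α)` in mean square. -/
theorem integral_noisyStep_sub_sq_le (hD : LipschitzWith L D) (hα : 0 < α) (hα1 : α ≤ 1)
    (x w : E) :
    ∫ z, ‖noisyStep D α w z - x‖ ^ 2 ∂(isoGaussian E s)
      ≤ (1 + (1 + 4 * (L : ℝ) ^ 2) * α) * ‖w - x‖ ^ 2
        + (4 * α * ‖D x‖ ^ 2 + α ^ 2 * noiseMoment E s) := by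
  have e : ∀ z, noisyStep D α w z - x = (w - x - α • D w) + (-α) • z := by
    intro z
    unfold noisyStep
    rw [smul_add, neg_smul]
    abel
  simp_rw [e]
  rw [integral_norm_add_sq_isoGaussian, norm_sub_sq_real, inner_smul_right, norm_smul, mul_pow,
    Real.norm_eq_abs, sq_abs]
  have h1 := norm_sq_le_of_lipschitz hD x w
  have h2 := real_inner_le_norm (w - x) (-D w)
  rw [inner_neg_right, norm_neg] at h2
  have h3 : -(2 * inner ℝ (w - x) (D w)) ≤ ‖w - x‖ ^ 2 + ‖D w‖ ^ 2 := by
    nlinarith [sq_nonneg (‖w - x‖ - ‖D w‖)]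
  have h4 := mul_le_mul_of_nonneg_left h3 hα.le
  have h5 : α ^ 2 * ‖D w‖ ^ 2 ≤ α * ‖D w‖ ^ 2 :=
    mul_le_mul_of_nonneg_right (by nlinarith) (sq_nonneg _)
  have h6 := mul_le_mul_of_nonneg_left h1 hα.le
  nlinarith

theorem integral_stepLaw_sub_sq_le (hD : LipschitzWith L D) (hα : 0 < α) (hα1 : α ≤ 1)
    (x : E) {m : Measure E} [IsProbabilityMeasure m] (hm : MemLp (fun w : E => w) 2 m) :
    ∫ w, ‖w - x‖ ^ 2 ∂(stepLaw D α s m)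
      ≤ (1 + (1 + 4 * (L : ℝ) ^ 2) * α) * ∫ w, ‖w - x‖ ^ 2 ∂m
        + (4 * α * ‖D x‖ ^ 2 + α ^ 2 * noiseMoment E s) := by
  have := isProbabilityMeasure_stepLaw (α := α) (s := s) hD.continuous m
  have hi := integrable_norm_sub_sq (memLp_stepLaw (α := α) (s := s) hD hm) x
  have hj := (integrable_norm_sub_sq hm x).const_mul (1 + (1 + 4 * (L : ℝ) ^ 2) * α)
  rw [integral_stepLaw hD.continuous hi, ← integral_const_mul]
  refine (integral_mono (integrable_integral_stepLaw hD.continuous hi)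
    (hj.add (integrable_const _))
    fun w => integral_noisyStep_sub_sq_le hD hα hα1 x w).trans (le_of_eq ?_)
  simp only [Pi.add_apply]
  rw [integral_add hj (integrable_const _)]
  simp

/-- A crude discrete Grönwall inequality, with each of the `t` increments amplified by at most `β ^
t`. -/
theorem le_of_linear_recursion {a : ℕ → ℝ} {β q : ℝ} (hβ : 1 ≤ β) (hq : 0 ≤ q) (h0 : a 0 ≤ 0)
    (h : ∀ t, a (t + 1) ≤ β * a t + q) (t : ℕ) : a t ≤ t * q * β ^ t := by
  induction t with
  | zero => simpa using h0
  | succ t ih =>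
    have h1 : 1 ≤ β ^ (t + 1) := one_le_pow₀ hβ
    have h2 := mul_le_mul_of_nonneg_left ih (zero_le_one.trans hβ)
    have h3 := mul_le_mul_of_nonneg_left h1 hq
    push_cast
    calc a (t + 1) ≤ β * (t * q * β ^ t) + q * β ^ (t + 1) := by linarith [h t]
      _ = _ := by ring

theorem integral_iterLaw_sub_sq_le (hD : LipschitzWith L D) (hα : 0 < α) (hα1 : α ≤ 1)
    (x : E) (t : ℕ) :
    ∫ w, ‖w - x‖ ^ 2 ∂(iterLaw D α s x t)
      ≤ t * (4 * α * ‖D x‖ ^ 2 + α ^ 2 * noiseMoment E s)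
        * (1 + (1 + 4 * (L : ℝ) ^ 2) * α) ^ t := by
  have hM := noiseMoment_nonneg (E := E) s
  refine le_of_linear_recursion (a := fun t => ∫ w, ‖w - x‖ ^ 2 ∂(iterLaw D α s x t))
    (le_add_of_nonneg_right (by positivity)) (by positivity) ?_ (fun t => ?_) t
  · simp [iterLaw_zero]
  · have := isProbabilityMeasure_iterLaw (α := α) (s := s) hD.continuous x t
    simp only [iterLaw_succ]
    exact integral_stepLaw_sub_sq_le hD hα hα1 x (memLp_iterLaw hD x t)

end NoisyDescent

/-! ### Characteristic function of the linearised gradient along an escape direction -/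

section NoisyDescent

variable {E : Type*} [NormedAddCommGroup E] [InnerProductSpace ℝ E] [FiniteDimensional ℝ E]
  [MeasurableSpace E] [BorelSpace E]

/-- The affine model at `x` of the component of a field `D` in an eigendirection `v` of its
derivative, with eigenvalue `μ`. -/
noncomputable def affineModel (D : E → E) (x v : E) (μ : ℝ) (w : E) : ℝ :=
  inner ℝ v (D x) + μ * inner ℝ v (w - x)

/-- `v` is a unit vector in which the field `D` is, up to a quadratic error, an expansion
around `x` with rate `-μ ≥ γ`. -/
structure IsEscapeDirection (D : E → E) (L : ℝ≥0) (LH γ : ℝ) (x v : E) (μ : ℝ) : Prop where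
  norm_eq : ‖v‖ = 1
  le_neg : μ ≤ -γ
  abs_le : |μ| ≤ L
  approx : ∀ w, |inner ℝ v (D w) - affineModel D x v μ w| ≤ LH * ‖w - x‖ ^ 2

variable {D : E → E} {L : ℝ≥0} {LH γ α s μ : ℝ} {x v : E}

theorem continuous_affineModel : Continuous (affineModel D x v μ) := by
  unfold affineModel
  fun_prop

theorem integrable_exp_I_mul {m : Measure E} [IsFiniteMeasure m] {c : E → ℝ}
    (hc : Continuous c) : Integrable (fun w => Complex.exp (Complex.I * (c w : ℂ))) m := by
  refine (integrable_const (1 : ℝ)).mono' (by fun_prop) (Eventually.of_forall fun w => ?_)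
  rw [mul_comm, Complex.norm_exp_ofReal_mul_I]

theorem affineModel_noisyStep (w z : E) :
    affineModel D x v μ (noisyStep D α w z)
      = (1 - α * μ) * affineModel D x v μ w
        - α * μ * (inner ℝ v (D w) - affineModel D x v μ w) - α * μ * inner ℝ z v := by
  unfold affineModel noisyStep
  rw [show w - α • (D w + z) - x = (w - x) - α • (D w + z) by abel, inner_sub_right v (w - x),
    inner_smul_right, inner_add_right, real_inner_comm v z]
  ring

theorem norm_exp_I_sub_exp_I_le (a b : ℝ) :
    ‖Complex.exp (Complex.I * (a : ℂ)) - Complex.exp (Complex.I * (b : ℂ))‖ ≤ |a - b| := by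
  have e : Complex.exp (Complex.I * (a : ℂ)) - Complex.exp (Complex.I * (b : ℂ))
      = Complex.exp (Complex.I * (b : ℂ)) * (Complex.exp (Complex.I * ((a - b : ℝ) : ℂ)) - 1) := by
    rw [mul_sub, ← Complex.exp_add]
    push_cast
    ring_nf
  rw [e, norm_mul, mul_comm Complex.I, Complex.norm_exp_ofReal_mul_I, one_mul]
  exact Real.norm_exp_I_mul_ofReal_sub_one_le

/-- Given the current point, the new noise is integrated exactly and contributes the Gaussian
factor. Replacing the true component of `D` by its affine model then costs at most the phase
difference, as `t ↦ exp (i t)` is 1-Lipschitz. -/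
theorem norm_integral_exp_stepLaw_le (hD : LipschitzWith L D) (hα : 0 < α)
    (hv : IsEscapeDirection D L LH γ x v μ) (l : ℝ) {m : Measure E} [IsProbabilityMeasure m]
    (hm : MemLp (fun w : E => w) 2 m) :
    ‖∫ w, Complex.exp (Complex.I * ((l * affineModel D x v μ w : ℝ) : ℂ)) ∂(stepLaw D α s m)‖
      ≤ Real.exp (-(s ^ 2 * (l * (α * μ)) ^ 2 / 2)) *
        (‖∫ w, Complex.exp (Complex.I * ((l * (1 - α * μ) * affineModel D x v μ w : ℝ) : ℂ)) ∂m‖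
          + |l| * (α * |μ| * LH * ∫ w, ‖w - x‖ ^ 2 ∂m)) := by
  have hDc := hD.continuous
  have hac : Continuous (affineModel D x v μ) := continuous_affineModel
  have := isProbabilityMeasure_stepLaw (α := α) (s := s) hDc m
  set A : E → ℂ := fun w => Complex.exp (Complex.I * ((l * ((1 - α * μ) * affineModel D x v μ w
    - α * μ * (inner ℝ v (D w) - affineModel D x v μ w)) : ℝ) : ℂ)) with hA
  set B : E → ℂ := fun w =>
    Complex.exp (Complex.I * ((l * (1 - α * μ) * affineModel D x v μ w : ℝ) : ℂ)) with hB
  have hAi : Integrable A m := integrable_exp_I_mul (by fun_prop)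
  have hBi : Integrable B m := integrable_exp_I_mul (by fun_prop)
  have hfib : ∀ w, ∫ z, Complex.exp (Complex.I *
      ((l * affineModel D x v μ (noisyStep D α w z) : ℝ) : ℂ)) ∂(isoGaussian E s)
      = A w * charFun (isoGaussian E s) ((-(l * (α * μ))) • v) := by
    intro w
    rw [charFun_apply, ← integral_const_mul]
    refine integral_congr_ae (Eventually.of_forall fun z => ?_)
    simp only [hA]
    rw [← Complex.exp_add, affineModel_noisyStep, inner_smul_right]
    push_cast
    ring_nf
  rw [integral_stepLaw hDc (integrable_exp_I_mul (by fun_prop))]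
  simp_rw [hfib]
  rw [integral_mul_const, norm_mul, charFun_isoGaussian, norm_smul, hv.norm_eq, mul_one,
    Real.norm_eq_abs, sq_abs, neg_sq, ← Complex.ofReal_neg, ← Complex.ofReal_exp,
    Complex.norm_real, Real.norm_of_nonneg (Real.exp_pos _).le, mul_comm]
  refine mul_le_mul_of_nonneg_left ?_ (Real.exp_pos _).le
  have hsub : ‖∫ w, A w ∂m - ∫ w, B w ∂m‖ ≤ |l| * (α * |μ| * LH * ∫ w, ‖w - x‖ ^ 2 ∂m) := by
    rw [← integral_sub hAi hBi]
    have hint := ((integrable_norm_sub_sq hm x).const_mul (|l| * (α * |μ| * LH)))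
    have := norm_integral_le_of_norm_le (f := fun w => A w - B w) hint
      (Eventually.of_forall fun w => ?_)
    · rwa [integral_const_mul, mul_assoc] at this
    · refine (norm_exp_I_sub_exp_I_le _ _).trans ?_
      have e : l * ((1 - α * μ) * affineModel D x v μ w
          - α * μ * (inner ℝ v (D w) - affineModel D x v μ w))
          - l * (1 - α * μ) * affineModel D x v μ w
          = -(l * (α * μ) * (inner ℝ v (D w) - affineModel D x v μ w)) := by ring
      rw [e, abs_neg, abs_mul, abs_mul, abs_mul, abs_of_pos hα]
      have := mul_le_mul_of_nonneg_left (hv.approx w)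
        (show 0 ≤ |l| * (α * |μ|) by positivity)
      linarith
  have h1 := norm_add_le (∫ w, B w ∂m) (∫ w, A w ∂m - ∫ w, B w ∂m)
  rw [add_sub_cancel] at h1
  linarith

/-- The characteristic function of the affine model along noisy gradient descent decays at
least like that of a Gaussian whose variance grows linearly in time. -/
theorem norm_integral_exp_iterLaw_le (hD : LipschitzWith L D) (hα : 0 < α) (hγ : 0 ≤ γ)
    (hLH : 0 ≤ LH) (hv : IsEscapeDirection D L LH γ x v μ) {U : ℝ} {T : ℕ}
    (hU : ∀ t ≤ T, ∫ w, ‖w - x‖ ^ 2 ∂(iterLaw D α s x t) ≤ U) :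
    ∀ t ≤ T, ∀ l : ℝ,
      ‖∫ w, Complex.exp (Complex.I * ((l * affineModel D x v μ w : ℝ) : ℂ))
        ∂(iterLaw D α s x t)‖
      ≤ Real.exp (-(l ^ 2 * (s ^ 2 * α ^ 2 * γ ^ 2 * t) / 2))
        + |l| * (t * (α * L * LH * U) * (1 + α * L) ^ t) := by
  have hU0 : 0 ≤ U := (integral_nonneg fun _ => by positivity).trans (hU 0 (Nat.zero_le _))
  have hμγ : γ ≤ |μ| := by
    have := neg_abs_le μ
    linarith [hv.le_neg]
  have hμ0 : |μ| = -μ := abs_of_nonpos (by linarith [hv.le_neg])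
  have hαμ : 1 ≤ 1 - α * μ := by nlinarith [abs_nonneg μ]
  have hαμL : 1 - α * μ ≤ 1 + α * L := by nlinarith [hv.abs_le]
  -- The frequency stays universally quantified in the induction, because one step back in time
  -- rescales `l` by `1 - α * μ`. This factor is at least `1`, so the Gaussian decay already
  -- accumulated can only improve.
  intro t
  induction t with
  | zero =>
    intro _ l
    simp [iterLaw_zero]
    rw [mul_comm, ← Complex.ofReal_mul, Complex.norm_exp_ofReal_mul_I]
  | succ t ih =>
    intro ht l
    have := isProbabilityMeasure_iterLaw (α := α) (s := s) hD.continuous x t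
    rw [iterLaw_succ]
    refine (norm_integral_exp_stepLaw_le hD hα hv l (memLp_iterLaw hD x t)).trans ?_
    have h1 := ih (by omega) (l * (1 - α * μ))
    have h2 := hU t (by omega)
    set X := ‖∫ w, Complex.exp (Complex.I * ((l * (1 - α * μ) * affineModel D x v μ w : ℝ) : ℂ))
      ∂(iterLaw D α s x t)‖
    set I := ∫ w, ‖w - x‖ ^ 2 ∂(iterLaw D α s x t)
    set G := Real.exp (-(s ^ 2 * (l * (α * μ)) ^ 2 / 2)) with hG
    have hG1 : G ≤ 1 := Real.exp_le_one_iff.2 (by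
      have : 0 ≤ s ^ 2 * (l * (α * μ)) ^ 2 := by positivity
      linarith)
    have hG0 : 0 ≤ G := (Real.exp_pos _).le
    have hsq : γ ^ 2 ≤ μ ^ 2 := by rw [← sq_abs μ]; gcongr
    have hmain : G * Real.exp (-((l * (1 - α * μ)) ^ 2 * (s ^ 2 * α ^ 2 * γ ^ 2 * t) / 2))
        ≤ Real.exp (-(l ^ 2 * (s ^ 2 * α ^ 2 * γ ^ 2 * (t + 1 : ℕ)) / 2)) := by
      rw [hG, ← Real.exp_add, Real.exp_le_exp]
      have a1 : 1 ≤ (1 - α * μ) ^ 2 := one_le_pow₀ hαμ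
      have a2 : 0 ≤ l ^ 2 * (s ^ 2 * α ^ 2 * γ ^ 2 * t) := by positivity
      have a3 := mul_le_mul_of_nonneg_left a1 a2
      have a4 := mul_le_mul_of_nonneg_left hsq (show 0 ≤ s ^ 2 * l ^ 2 * α ^ 2 by positivity)
      push_cast
      nlinarith
    have hle : ∀ Y, 0 ≤ Y → G * Y ≤ Y := fun Y hY => mul_le_of_le_one_left hY hG1
    have hR : |l * (1 - α * μ)| * (t * (α * L * LH * U) * (1 + α * L) ^ t)
        + |l| * (α * |μ| * LH * I)
        ≤ |l| * ((t + 1 : ℕ) * (α * L * LH * U) * (1 + α * L) ^ (t + 1)) := by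
      rw [abs_mul, abs_of_nonneg (by linarith : 0 ≤ 1 - α * μ)]
      have b1 : (1 - α * μ) * (t * (α * L * LH * U) * (1 + α * L) ^ t)
          ≤ (1 + α * L) * (t * (α * L * LH * U) * (1 + α * L) ^ t) := by gcongr
      have b2 : α * |μ| * LH * I ≤ α * L * LH * U * (1 + α * L) ^ (t + 1) := by
        have c1 : α * |μ| * LH * I ≤ α * L * LH * U := by
          have := hv.abs_le
          have hI : 0 ≤ I := integral_nonneg fun _ => by positivity
          gcongr
        have c2 : 1 ≤ (1 + α * (L : ℝ)) ^ (t + 1) :=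
          one_le_pow₀ (le_add_of_nonneg_right (by positivity))
        exact c1.trans (le_mul_of_one_le_right (by positivity) c2)
      push_cast
      calc |l| * (1 - α * μ) * (t * (α * L * LH * U) * (1 + α * L) ^ t) + |l| * (α * |μ| * LH * I)
          = |l| * ((1 - α * μ) * (t * (α * L * LH * U) * (1 + α * L) ^ t)
            + α * |μ| * LH * I) := by ring
        _ ≤ |l| * ((1 + α * L) * (t * (α * L * LH * U) * (1 + α * L) ^ t)
            + α * L * LH * U * (1 + α * L) ^ (t + 1)) := by gcongr
        _ = _ := by ring
    have hI0 : 0 ≤ I := integral_nonneg fun _ => by positivity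
    calc G * (X + |l| * (α * |μ| * LH * I))
        ≤ G * (Real.exp (-((l * (1 - α * μ)) ^ 2 * (s ^ 2 * α ^ 2 * γ ^ 2 * t) / 2))
          + |l * (1 - α * μ)| * (t * (α * L * LH * U) * (1 + α * L) ^ t)
          + |l| * (α * |μ| * LH * I)) := by gcongr
      _ = G * Real.exp (-((l * (1 - α * μ)) ^ 2 * (s ^ 2 * α ^ 2 * γ ^ 2 * t) / 2))
          + G * (|l * (1 - α * μ)| * (t * (α * L * LH * U) * (1 + α * L) ^ t)
          + |l| * (α * |μ| * LH * I)) := by ring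
      _ ≤ _ := add_le_add hmain ((hle _ (by positivity)).trans hR)

/-- A lower bound for the second moment of the field in terms of the characteristic function of
its affine model. -/
theorem le_integral_norm_sq_field (hD : LipschitzWith L D)
    (hv : IsEscapeDirection D L LH γ x v μ) {l : ℝ} (hl : 0 < l) {m : Measure E}
    [IsProbabilityMeasure m] (hm : MemLp (fun w : E => w) 2 m) :
    2 / l ^ 2 * (1 - ‖∫ w, Complex.exp (Complex.I * ((l * affineModel D x v μ w : ℝ) : ℂ)) ∂m‖
      - l * (LH * ∫ w, ‖w - x‖ ^ 2 ∂m)) ≤ ∫ w, ‖D w‖ ^ 2 ∂m := by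
  have hac : Continuous (affineModel D x v μ) := continuous_affineModel
  have hi : Integrable (fun w => Complex.exp (Complex.I * ((l * affineModel D x v μ w : ℝ) : ℂ)))
    m := integrable_exp_I_mul (by fun_prop)
  have hre : ∫ w, Real.cos (l * affineModel D x v μ w) ∂m
      ≤ ‖∫ w, Complex.exp (Complex.I * ((l * affineModel D x v μ w : ℝ) : ℂ)) ∂m‖ := by
    refine le_trans (le_of_eq ?_) (Complex.re_le_norm _)
    have := integral_re hi
    simp only [RCLike.re_eq_complex_re] at this
    rw [← this]
    refine integral_congr_ae (Eventually.of_forall fun w => ?_)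
    simp only
    rw [mul_comm Complex.I, Complex.exp_ofReal_mul_I_re]
  have hc : Integrable (fun w => Real.cos (l * affineModel D x v μ w)) m :=
    (integrable_const (1 : ℝ)).mono' (by fun_prop)
      (Eventually.of_forall fun w => Real.abs_cos_le_one _)
  have hn := (integrable_norm_sub_sq hm x).const_mul (l * LH)
  have hpt : ∀ w, 2 / l ^ 2 * (1 - Real.cos (l * affineModel D x v μ w)
      - l * LH * ‖w - x‖ ^ 2) ≤ ‖D w‖ ^ 2 := by
    intro w
    -- The quadratic bound on cosine is applied to the true component of `D`; the Lipschitz bound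
    -- for cosine then passes to the affine model at a cost linear in the error.
    have h1 := Real.one_sub_sq_div_two_le_cos (x := l * inner ℝ v (D w))
    have h2 := (abs_le.1 (Real.abs_cos_sub_cos_le (l * inner ℝ v (D w))
      (l * affineModel D x v μ w))).2
    rw [← mul_sub, abs_mul, abs_of_pos hl] at h2
    have h3 := mul_le_mul_of_nonneg_left (hv.approx w) hl.le
    have h4 : inner ℝ v (D w) ^ 2 ≤ ‖D w‖ ^ 2 := by
      have := abs_real_inner_le_norm v (D w)
      rw [hv.norm_eq, one_mul] at this
      rw [← sq_abs]
      gcongr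
    rw [div_mul_eq_mul_div, div_le_iff₀ (by positivity)]
    nlinarith [sq_nonneg l, mul_le_mul_of_nonneg_left h4 (sq_nonneg l)]
  have h1c : Integrable (fun w => 1 - Real.cos (l * affineModel D x v μ w)) m :=
    (integrable_const _).sub hc
  have hfin := integral_mono ((h1c.sub hn).const_mul (2 / l ^ 2))
    (integrable_norm_sq_field hD hm) hpt
  simp only [Pi.sub_apply] at hfin
  rw [integral_const_mul, integral_sub h1c hn, integral_sub (integrable_const _) hc,
    integral_const_mul] at hfin
  simp only [integral_const, probReal_univ, smul_eq_mul, one_mul] at hfin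
  refine le_trans ?_ hfin
  gcongr ?_ * ?_
  linarith

end NoisyDescent

/-! ### Expected decrease near a strict saddle -/

section NoisyDescent

variable {E : Type*} [NormedAddCommGroup E] [InnerProductSpace ℝ E] [FiniteDimensional ℝ E]
  [MeasurableSpace E] [BorelSpace E]

theorem one_add_mul_pow_le_exp {κ α B : ℝ} {t : ℕ} (hκ : 0 ≤ κ) (hα : 0 ≤ α)
    (h : α * t ≤ B) : (1 + κ * α) ^ t ≤ Real.exp (κ * B) := by
  calc (1 + κ * α) ^ t ≤ Real.exp (κ * α) ^ t := by
        gcongr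
        linarith [Real.add_one_le_exp (κ * α)]
    _ = Real.exp (κ * (α * t)) := by rw [← Real.exp_nat_mul]; ring_nf
    _ ≤ _ := by gcongr

/-- If the second moment of the gradient is at least `e` along the second half of the trajectory,
the expected objective decreases accordingly. -/
theorem IsSmoothObjective.integral_iterLaw_le {Ψ : E → ℝ} {D : E → E} {L : ℝ≥0} {b α s e : ℝ}
    (h : IsSmoothObjective Ψ D L b) (hα : 0 < α) (hαL : α * L ≤ 1 / 2) (x : E) (T : ℕ)
    (he : ∀ t < T, T ≤ 2 * t → e ≤ ∫ w, ‖D w‖ ^ 2 ∂(iterLaw D α s x t)) :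
    ∫ w, Ψ w ∂(iterLaw D α s x T)
      ≤ Ψ x + T * (L * α ^ 2 * noiseMoment E s) - α / 2 * e * (T / 2 : ℕ) := by
  -- The truncated difference `t - (T + 1) / 2` counts the steps before `t` that lie in the second
  -- half; at `t = T` it equals `T / 2` rounded down.
  have key : ∀ t ≤ T, ∫ w, Ψ w ∂(iterLaw D α s x t)
      ≤ Ψ x + t * (L * α ^ 2 * noiseMoment E s) - α / 2 * e * (t - (T + 1) / 2 : ℕ) := by
    intro t
    induction t with
    | zero => simp [iterLaw_zero]
    | succ t ih =>
      intro ht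
      have := isProbabilityMeasure_iterLaw (α := α) (s := s) h.lipschitz.continuous x t
      have h1 := h.integral_stepLaw_le (s := s) hα hαL (memLp_iterLaw (α := α) (s := s)
        h.lipschitz x t)
      have h2 := ih (by omega)
      rw [← iterLaw_succ] at h1
      by_cases hc : T ≤ 2 * t
      · have h3 := mul_le_mul_of_nonneg_left (he t (by omega) hc) (half_pos hα).le
        rw [show t + 1 - (T + 1) / 2 = (t - (T + 1) / 2) + 1 by omega]
        push_cast
        nlinarith
      · have h3 : 0 ≤ α / 2 * ∫ w, ‖D w‖ ^ 2 ∂(iterLaw D α s x t) :=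
          mul_nonneg (half_pos hα).le (integral_nonneg fun _ => by positivity)
        rw [show t + 1 - (T + 1) / 2 = 0 by omega]
        rw [show t - (T + 1) / 2 = 0 by omega] at h2
        push_cast
        push_cast at h2
        nlinarith
  have := key T le_rfl
  rwa [show T - (T + 1) / 2 = T / 2 by omega] at this

set_option maxHeartbeats 400000 in
variable (E) in
/-- Escape from a strict saddle: started where the gradient is of order `√α` and an escape
direction exists, noisy gradient descent decreases the objective in expectation by at least `c`
times `α²` per iteration over some finite horizon, where `c` may be prescribed beforehand. -/
theorem exists_escape_stepSize (L : ℝ≥0) {LH γ s c C : ℝ} (hLH : 0 ≤ LH) (hγ : 0 < γ)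
    (hs : 0 < s) (hc : 0 < c) (hC : 0 ≤ C) :
    ∃ αbar : ℝ, 0 < αbar ∧ ∀ α : ℝ, 0 < α → α ≤ αbar →
      ∀ (Ψ : E → ℝ) (D : E → E) (b : ℝ), IsSmoothObjective Ψ D L b →
      ∀ (x v : E) (μ : ℝ), IsEscapeDirection D L LH γ x v μ → ‖D x‖ ^ 2 ≤ C * α →
      ∃ T : ℕ, 1 ≤ T ∧ ∫ w, Ψ w ∂(iterLaw D α s x T) ≤ Ψ x - c * α ^ 2 * T := by
  set M := noiseMoment E s
  have hM : 0 ≤ M := noiseMoment_nonneg s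
  have hγs : 0 < γ ^ 2 * s ^ 2 := by positivity
  -- The guaranteed decrease is at least `α ^ 2 * T * (γ ^ 2 * s ^ 2 * τ) / 64`. This `τ` makes it
  -- pay for both the prescribed rate `c` and the noise cost `L * M`.
  set τ := 64 * (c + L * M) / (γ ^ 2 * s ^ 2) + 1 with hτ
  have hτ1 : 1 ≤ τ := le_add_of_nonneg_left (by positivity)
  have hτc : 64 * (c + L * M) ≤ γ ^ 2 * s ^ 2 * τ := by
    rw [hτ, mul_add (γ ^ 2 * s ^ 2), mul_div_cancel₀ _ hγs.ne']
    linarith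
  -- `CU` and `CR` are independent of `α`: over the horizon `α * t ≤ τ + 1`, the mean square
  -- displacement is at most `α * CU` and the characteristic function error at most `l * (α * CR)`.
  set CU := (τ + 1) * (4 * C + M) * Real.exp ((1 + 4 * (L : ℝ) ^ 2) * (τ + 1)) with hCU
  have hCU0 : 0 ≤ CU := by positivity
  set CR := (τ + 1) * (L * LH * CU) * Real.exp (L * (τ + 1)) with hCR
  have hCR0 : 0 ≤ CR := by positivity
  set C' := CR + LH * CU with hC'
  have hC'0 : 0 ≤ C' := by positivity
  refine ⟨min (1 / (2 * ((L : ℝ) + 1))) (γ ^ 2 * s ^ 2 * τ / (64 * (C' ^ 2 + 1))),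
    lt_min (by positivity) (by positivity), fun α hα hαle Ψ D b h x v μ hv hDx => ?_⟩
  have hα1 := hαle.trans (min_le_left _ _)
  have hα2 := hαle.trans (min_le_right _ _)
  rw [le_div_iff₀ (by positivity)] at hα1 hα2
  have hL0 : 0 ≤ α * (L : ℝ) := by positivity
  have hαL : α * L ≤ 1 / 2 := by linarith
  have hαh : α ≤ 1 / 2 := by linarith
  set T := ⌈τ / α⌉₊ with hT
  have hT1 : τ ≤ α * T := by
    have := Nat.le_ceil (τ / α)
    rw [div_le_iff₀ hα] at this
    linarith
  have hT2 : α * T ≤ τ + 1 := by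
    have := (Nat.ceil_lt_add_one (show 0 ≤ τ / α by positivity)).le
    have h2 := mul_le_mul_of_nonneg_left this hα.le
    rw [mul_add, mul_div_cancel₀ _ hα.ne'] at h2
    linarith
  have hTtwo : 2 ≤ T := by
    have h2 : α * T ≤ 1 / 2 * T := by gcongr
    have : (2 : ℝ) ≤ T := by linarith
    exact_mod_cast this
  have htT : ∀ t ≤ T, α * (t : ℝ) ≤ τ + 1 := fun t ht =>
    le_trans (by gcongr) hT2
  have hU : ∀ t ≤ T, ∫ w, ‖w - x‖ ^ 2 ∂(iterLaw D α s x t) ≤ α * CU := by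
    intro t ht
    refine (integral_iterLaw_sub_sq_le h.lipschitz hα (by linarith) x t).trans ?_
    calc t * (4 * α * ‖D x‖ ^ 2 + α ^ 2 * M) * (1 + (1 + 4 * (L : ℝ) ^ 2) * α) ^ t
        ≤ t * (4 * α * (C * α) + α ^ 2 * M) * Real.exp ((1 + 4 * (L : ℝ) ^ 2) * (τ + 1)) := by
          gcongr
          exact one_add_mul_pow_le_exp (by positivity) hα.le (htT t ht)
      _ = (α * t) * (α * (4 * C + M)) * Real.exp ((1 + 4 * (L : ℝ) ^ 2) * (τ + 1)) := by ring
      _ ≤ (τ + 1) * (α * (4 * C + M)) * Real.exp ((1 + 4 * (L : ℝ) ^ 2) * (τ + 1)) := by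
          gcongr
          exact htT t ht
      _ = α * CU := by rw [hCU]; ring
  set σ := α * (γ ^ 2 * s ^ 2 * τ) / 2 with hσ
  have hσ0 : 0 < σ := by positivity
  -- In the second half the Gaussian variance is at least `σ`, so this frequency makes the Gaussian
  -- factor at most `exp (-1) < 1 / 2`. The second bound on `α` keeps the errors below `1 / 4`,
  -- which leaves `σ / 4`.
  set l := √(2 / σ) with hl
  have hl0 : 0 < l := Real.sqrt_pos.2 (by positivity)
  have hl2 : l ^ 2 = 2 / σ := Real.sq_sqrt (by positivity)
  have hl2' : l ^ 2 * σ = 2 := by rw [hl2]; field_simp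
  have hsmall : l * (α * C') ≤ 1 / 4 := by
    refine abs_le_of_sq_le_sq' ?_ (by norm_num) |>.2
    have e1 : l ^ 2 * (α * (γ ^ 2 * s ^ 2 * τ)) = 4 := by rw [hσ] at hl2'; linarith
    have e2 : α * (64 * C' ^ 2) ≤ γ ^ 2 * s ^ 2 * τ := by linarith
    have e3 := mul_le_mul_of_nonneg_left e2 (show 0 ≤ l ^ 2 * α by positivity)
    linarith
  have he : ∀ t < T, T ≤ 2 * t → σ / 4 ≤ ∫ w, ‖D w‖ ^ 2 ∂(iterLaw D α s x t) := by
    intro t ht htt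
    have := isProbabilityMeasure_iterLaw (α := α) (s := s) h.lipschitz.continuous x t
    have h1 := le_integral_norm_sq_field h.lipschitz hv hl0 (memLp_iterLaw (α := α) (s := s)
      h.lipschitz x t)
    have h2 := norm_integral_exp_iterLaw_le h.lipschitz hα hγ.le hLH hv hU t ht.le l
    have h3 : Real.exp (-(l ^ 2 * (s ^ 2 * α ^ 2 * γ ^ 2 * t) / 2)) ≤ 1 / 2 := by
      have hs1 : σ ≤ s ^ 2 * α ^ 2 * γ ^ 2 * t := by
        have : (T : ℝ) ≤ 2 * t := by exact_mod_cast htt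
        have h5 : τ ≤ 2 * (α * t) := by
          have := mul_le_mul_of_nonneg_left this hα.le
          linarith
        have h6 := mul_le_mul_of_nonneg_left h5 (show 0 ≤ α * (γ ^ 2 * s ^ 2) by positivity)
        rw [hσ]
        linarith
      have hs2 := mul_le_mul_of_nonneg_left hs1 (sq_nonneg l)
      have hs3 : Real.exp (-(l ^ 2 * (s ^ 2 * α ^ 2 * γ ^ 2 * t) / 2)) ≤ Real.exp (-1) := by
        rw [Real.exp_le_exp]
        linarith
      have := Real.exp_neg_one_lt_half
      linarith
    have h4 : t * (α * L * LH * (α * CU)) * (1 + α * L) ^ t ≤ α * CR := by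
      have h5 := one_add_mul_pow_le_exp (κ := L) (by positivity) hα.le (htT t ht.le)
      rw [mul_comm (L : ℝ) α] at h5
      calc t * (α * L * LH * (α * CU)) * (1 + α * L) ^ t
          ≤ t * (α * L * LH * (α * CU)) * Real.exp (L * (τ + 1)) := by gcongr
        _ = (α * t) * (α * (L * LH * CU)) * Real.exp (L * (τ + 1)) := by ring
        _ ≤ (τ + 1) * (α * (L * LH * CU)) * Real.exp (L * (τ + 1)) := by
            gcongr
            exact htT t ht.le
        _ = α * CR := by rw [hCR]; ring
    have h6 := mul_le_mul_of_nonneg_left h4 hl0.le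
    have h7 := mul_le_mul_of_nonneg_left (mul_le_mul_of_nonneg_left (hU t ht.le) hLH) hl0.le
    rw [abs_of_pos hl0] at h2
    have h8 : 2 / l ^ 2 = σ := by rw [hl2]; field_simp
    rw [h8] at h1
    refine le_trans ?_ h1
    have h9 : l * (α * C') = l * (α * CR) + l * (LH * (α * CU)) := by rw [hC']; ring
    rw [show σ / 4 = σ * (1 / 4) by ring]
    gcongr
    linarith
  refine ⟨T, by omega, (h.integral_iterLaw_le hα hαL x T he).trans ?_⟩
  have hT4 : (T : ℝ) / 4 ≤ (T / 2 : ℕ) := by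
    have : T ≤ 4 * (T / 2) := by omega
    have : (T : ℝ) ≤ 4 * (T / 2 : ℕ) := by exact_mod_cast this
    linarith
  have h1 := mul_le_mul_of_nonneg_left hT4 (show 0 ≤ α / 2 * (σ / 4) by positivity)
  have h2 := mul_le_mul_of_nonneg_left hτc (show 0 ≤ α ^ 2 * T by positivity)
  have h3 : α / 2 * (σ / 4) * (T / 4) = α ^ 2 * T * (γ ^ 2 * s ^ 2 * τ) / 64 := by
    rw [hσ]; ring
  linarith

end NoisyDescent

/-! ### Survival probabilities and the stopping argument -/

section NoisyDescent

variable {E : Type*} [NormedAddCommGroup E] [InnerProductSpace ℝ E] [FiniteDimensional ℝ E]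
  [MeasurableSpace E] [BorelSpace E]

/-- The probability that the first `K` points of noisy gradient descent started at `x`
avoid the set `S`. -/
noncomputable def survival (D : E → E) (α s : ℝ) (S : Set E) : ℕ → E → ℝ
  | 0 => fun _ => 1
  | K + 1 => Sᶜ.indicator fun x => ∫ z, survival D α s S K (noisyStep D α x z) ∂(isoGaussian E s)

variable {D : E → E} {α s : ℝ} {S : Set E}

theorem measurable_survival (hD : Continuous D) (hS : MeasurableSet S) (K : ℕ) :
    Measurable (survival D α s S K) := by
  induction K with
  | zero => exact measurable_const
  | succ K ih =>
    refine Measurable.indicator ?_ hS.compl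
    have : StronglyMeasurable (Function.uncurry fun x z => survival D α s S K
        (noisyStep D α x z)) :=
      (ih.comp (measurable_noisyStep hD)).stronglyMeasurable
    exact this.integral_prod_right.measurable

theorem survival_mem_Icc (K : ℕ) (x : E) : survival D α s S K x ∈ Set.Icc (0 : ℝ) 1 := by
  induction K generalizing x with
  | zero => simp [survival]
  | succ K ih =>
    by_cases hx : x ∈ S
    · simp [survival, hx]
    · rw [survival, Set.indicator_of_mem (by simpa using hx)]
      refine ⟨integral_nonneg fun z => (ih _).1, ?_⟩
      have := norm_integral_le_of_norm_le_const (μ := isoGaussian E s) (C := 1)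
        (f := fun z => survival D α s S K (noisyStep D α x z)) (Eventually.of_forall fun z => by
          rw [Real.norm_of_nonneg (ih _).1]
          exact (ih _).2)
      simp only [probReal_univ, mul_one] at this
      exact (le_abs_self _).trans this

theorem integrable_of_mem_Icc {Ω : Type*} [MeasurableSpace Ω] {m : Measure Ω} [IsFiniteMeasure m]
    {φ : Ω → ℝ} (hφ : Measurable φ) (h : ∀ ω, φ ω ∈ Set.Icc (0 : ℝ) 1) : Integrable φ m :=
  (integrable_const (1 : ℝ)).mono' hφ.aestronglyMeasurable (Eventually.of_forall fun ω => by
    rw [Real.norm_of_nonneg (h ω).1]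
    exact (h ω).2)

theorem integrable_survival (hD : Continuous D) (hS : MeasurableSet S) (K : ℕ) {m : Measure E}
    [IsFiniteMeasure m] : Integrable (survival D α s S K) m :=
  integrable_of_mem_Icc (measurable_survival hD hS K) (survival_mem_Icc K)

theorem integral_survival_succ_le (hD : Continuous D) (hS : MeasurableSet S) (K : ℕ)
    {m : Measure E} [IsProbabilityMeasure m] :
    ∫ x, survival D α s S (K + 1) x ∂m ≤ ∫ x, survival D α s S K x ∂(stepLaw D α s m) := by
  have := isProbabilityMeasure_stepLaw (α := α) (s := s) hD m
  have hi := integrable_survival (α := α) (s := s) hD hS K (m := stepLaw D α s m)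
  rw [integral_stepLaw hD hi]
  refine integral_mono (integrable_survival hD hS _) (integrable_integral_stepLaw hD hi)
    fun x => ?_
  exact Set.indicator_le_self' (fun x _ => integral_nonneg fun z => (survival_mem_Icc _ _).1) x

/-- Avoidance is simply forgotten during the first `T` steps. This allows a decrease known only at
the end of a horizon to be used, whether or not the path meets `S` earlier. -/
theorem survival_add_le (hD : Continuous D) (hS : MeasurableSet S) (x : E) (T : ℕ) (j : ℕ) :
    survival D α s S (j + T) x ≤ ∫ w, survival D α s S j w ∂(iterLaw D α s x T) := by
  induction T generalizing j with
  | zero => simp [iterLaw_zero]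
  | succ T ih =>
    have := isProbabilityMeasure_iterLaw (α := α) (s := s) hD x T
    rw [iterLaw_succ, show j + (T + 1) = (j + 1) + T by ring]
    exact (ih (j + 1)).trans (integral_survival_succ_le hD hS j)

/-- If from every point outside `S` the objective decreases in expectation by `c` per iteration
over some finite horizon, then the survival probability is at most inversely proportional to the
number of iterations. -/
theorem IsSmoothObjective.mul_survival_le {Ψ : E → ℝ} {L : ℝ≥0} {b c : ℝ}
    (h : IsSmoothObjective Ψ D L b) (hS : MeasurableSet S) (hc : 0 ≤ c)
    (hdec : ∀ x ∉ S, ∃ T : ℕ, 1 ≤ T ∧ ∫ w, Ψ w ∂(iterLaw D α s x T) ≤ Ψ x - c * T)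
    (K : ℕ) (x : E) : c * K * survival D α s S K x ≤ Ψ x - b := by
  have hD := h.lipschitz.continuous
  induction K using Nat.strong_induction_on generalizing x with
  | _ K ih =>
    have hb := h.lower x
    obtain ⟨h0, h1⟩ := survival_mem_Icc (D := D) (α := α) (s := s) (S := S) K x
    by_cases hx : x ∈ S
    · rcases K with _ | K
      · simpa using hb
      · simpa [survival, hx] using hb
    · obtain ⟨T, hT1, hT⟩ := hdec x hx
      have := isProbabilityMeasure_iterLaw (α := α) (s := s) hD x T
      have hΨ := h.integrable (memLp_iterLaw (α := α) (s := s) h.lipschitz x T)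
      -- A horizon covering all of `K` suffices because survival is at most `1`. Otherwise the
      -- remaining `j` steps are handled by induction at the random endpoint. `K` is deterministic,
      -- so `T` need not depend measurably on `x`.
      rcases le_total K T with hKT | hKT
      · have h2 : b ≤ ∫ w, Ψ w ∂(iterLaw D α s x T) := by
          simpa using integral_mono (integrable_const b) hΨ h.lower
        have h3 : c * K * survival D α s S K x ≤ c * K * 1 := by gcongr
        have h4 : c * K ≤ c * T := by gcongr
        linarith
      · obtain ⟨j, rfl⟩ := Nat.exists_eq_add_of_le' hKT
        have h2 := survival_add_le (α := α) (s := s) hD hS x T j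
        have hi := integrable_survival (α := α) (s := s) hD hS j (m := iterLaw D α s x T)
        have h3 : c * j * ∫ w, survival D α s S j w ∂(iterLaw D α s x T)
            ≤ ∫ w, Ψ w ∂(iterLaw D α s x T) - b := by
          rw [← integral_const_mul]
          have := integral_mono (hi.const_mul (c * j)) (hΨ.sub (integrable_const b))
            fun w => ih j (by omega) w
          simp only [Pi.sub_apply] at this
          rw [integral_sub hΨ (integrable_const b)] at this
          simpa using this
        have h4 := mul_le_mul_of_nonneg_left h2 (show 0 ≤ c * j by positivity)
        have h5 := mul_le_mul_of_nonneg_left h1 (show 0 ≤ c * T by positivity)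
        push_cast
        linarith

variable (E) in
-- The step size threshold precedes `Ψ`, `b` and `S`, so one value serves all initial allocations.
-- The first step is integrated separately because time `0` does not count as a visit to `S`, whence
-- the extra noise term on the right.
theorem exists_stepSize_survival (L : ℝ≥0) {LH γ s c ε : ℝ} (hLH : 0 ≤ LH) (hγ : 0 < γ)
    (hs : 0 < s) (hc : 0 < c) (hε : 0 < ε) :
    ∃ αbar : ℝ, 0 < αbar ∧ ∀ α : ℝ, 0 < α → α ≤ αbar →
      ∀ (Ψ : E → ℝ) (D : E → E) (b : ℝ), IsSmoothObjective Ψ D L b →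
      ∀ S : Set E, MeasurableSet S →
      (∀ x ∉ S, ε < ‖D x‖ ∨ ∃ v μ, IsEscapeDirection D L LH γ x v μ) →
      ∀ (K : ℕ) (x : E), c * α ^ 2 * K * ∫ z, survival D α s S K (noisyStep D α x z)
        ∂(isoGaussian E s) ≤ Ψ x - b + L * α ^ 2 * noiseMoment E s := by
  have hM := noiseMoment_nonneg (E := E) s
  -- This threshold separates the two regimes: `‖D x‖ ^ 2 > C * α` gives the required decrease in
  -- one step, while `α ≤ ε ^ 2 / C` forces `‖D x‖ ≤ ε` in the other case.
  set C := 2 * (c + L * noiseMoment E s) with hC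
  have hC0 : 0 < C := by positivity
  obtain ⟨α₀, hα₀, hesc⟩ := exists_escape_stepSize E L hLH hγ hs hc hC0.le
  refine ⟨min α₀ (min (1 / (2 * ((L : ℝ) + 1))) (ε ^ 2 / C)), by positivity,
    fun α hα hαle Ψ D b h S hS hout K x => ?_⟩
  have h1 := hαle.trans (min_le_left _ _)
  have h2 := hαle.trans ((min_le_right _ _).trans (min_le_left _ _))
  have h3 := hαle.trans ((min_le_right _ _).trans (min_le_right _ _))
  rw [le_div_iff₀ (by positivity)] at h2 h3
  have hαL : α * L ≤ 1 / 2 := by linarith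
  have hD := h.lipschitz.continuous
  have hsurv := h.mul_survival_le (α := α) (s := s) hS (c := c * α ^ 2) (by positivity)
    (fun x hx => by
      by_cases hx1 : ‖D x‖ ^ 2 ≤ C * α
      · rcases hout x hx with hg | ⟨v, μ, hv⟩
        · exfalso
          have : ε ^ 2 < ‖D x‖ ^ 2 := by gcongr
          linarith
        · exact hesc α hα h1 Ψ D b h x v μ hv hx1
      · refine ⟨1, le_rfl, ?_⟩
        have hd := h.integral_stepLaw_le (s := s) (m := Measure.dirac x) hα hαL
          (memLp_iterLaw (α := α) (s := s) h.lipschitz x 0)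
        rw [integral_dirac, integral_dirac] at hd
        rw [show iterLaw D α s x 1 = stepLaw D α s (Measure.dirac x) from iterLaw_succ _ _ _ _ _]
        have := mul_le_mul_of_nonneg_left (not_le.1 hx1).le (half_pos hα).le
        push_cast
        nlinarith) K
  have hd := h.integral_noisyStep_le (s := s) hα hαL x
  have hi := h.integrable_comp_noisyStep (α := α) (s := s) x
  have hc' : Measurable (fun z => noisyStep D α x z) :=
    (measurable_noisyStep hD).comp measurable_prodMk_left
  have hj : Integrable (fun z => survival D α s S K (noisyStep D α x z)) (isoGaussian E s) :=
    integrable_of_mem_Icc ((measurable_survival hD hS K).comp hc') fun z => survival_mem_Icc K _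
  have hm := integral_mono (hj.const_mul (c * α ^ 2 * K)) (hi.sub (integrable_const b))
    fun z => hsurv (noisyStep D α x z)
  simp only [Pi.sub_apply] at hm
  rw [integral_const_mul, integral_sub hi (integrable_const b)] at hm
  simp only [integral_const, probReal_univ, smul_eq_mul, one_mul] at hm
  have : 0 ≤ α / 2 * ‖D x‖ ^ 2 := by positivity
  linarith

end NoisyDescent

/-! ### Markov property of the noisy iteration -/

section Survival

variable {E : Type*} [NormedAddCommGroup E] [InnerProductSpace ℝ E] [FiniteDimensional ℝ E]
  [MeasurableSpace E] [BorelSpace E] {D : E → E} {α s : ℝ} {S : Set E}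

/-- The Markov property: a perturbation that is independent of the past may be integrated out. -/
theorem integral_indicator_comp_noisyStep {Ω : Type*} {ℱ : MeasurableSpace Ω}
    [mΩ : MeasurableSpace Ω] {P : Measure Ω} [IsProbabilityMeasure P] (hD : Continuous D) (hℱ : ℱ ≤ mΩ)
    {X ξ : Ω → E} (hX : Measurable[ℱ] X) (hξ : Measurable ξ) (hlaw : P.map ξ = isoGaussian E s)
    (hind : Indep ℱ (MeasurableSpace.comap ξ inferInstance) P) {B : Set Ω}
    (hB : MeasurableSet[ℱ] B) {h : E → ℝ} (hh : Measurable h)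
    (h01 : ∀ x, h x ∈ Set.Icc (0 : ℝ) 1) :
    ∫ ω, B.indicator (fun ω => h (noisyStep D α (X ω) (ξ ω))) ω ∂P
      = ∫ ω, B.indicator (fun ω => ∫ z, h (noisyStep D α (X ω) z) ∂(isoGaussian E s)) ω ∂P := by
  -- Carrying the indicator of `B` as a coordinate reduces the claim to independence of two random
  -- variables and Fubini for their product law.
  set Y : Ω → ℝ × E := fun ω => (B.indicator (fun _ => (1 : ℝ)) ω, X ω) with hY
  have hYm : Measurable[ℱ] Y := (measurable_const.indicator hB).prodMk hX
  have hYm' : Measurable Y := hYm.mono hℱ le_rfl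
  have hYξ : IndepFun Y ξ P := by
    rw [IndepFun_iff_Indep]
    exact indep_of_indep_of_le_left hind hYm.comap_le
  have hprod : P.map (fun ω => (Y ω, ξ ω)) = (P.map Y).prod (isoGaussian E s) := by
    rw [← hlaw]
    exact (indepFun_iff_map_prod_eq_prod_map_map hYm'.aemeasurable hξ.aemeasurable).1 hYξ
  have := Measure.isProbabilityMeasure_map (μ := P) hYm'.aemeasurable
  set g : (ℝ × E) × E → ℝ := fun q =>
    (({1} : Set ℝ).indicator (fun _ => (1 : ℝ)) q.1.1) * h (noisyStep D α q.1.2 q.2) with hg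
  have hgm : Measurable g := by
    refine Measurable.mul ?_ (hh.comp ((measurable_noisyStep hD).comp
      ((measurable_snd.comp measurable_fst).prodMk measurable_snd)))
    exact (measurable_const.indicator (measurableSet_singleton 1)).comp
      (measurable_fst.comp measurable_fst)
  have hg01 : ∀ q, g q ∈ Set.Icc (0 : ℝ) 1 := by
    intro q
    by_cases hq : q.1.1 ∈ ({1} : Set ℝ)
    · simp only [hg]
      rw [Set.indicator_of_mem hq, one_mul]
      exact h01 _
    · simp only [hg]
      rw [Set.indicator_of_notMem hq, zero_mul]
      exact ⟨le_rfl, zero_le_one⟩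
  have hgi : Integrable g ((P.map Y).prod (isoGaussian E s)) := integrable_of_mem_Icc hgm hg01
  have e1 : ∀ ω z, g (Y ω, z) = B.indicator (fun ω => h (noisyStep D α (X ω) z)) ω := by
    intro ω z
    by_cases hω : ω ∈ B <;> simp [hg, hY, hω]
  calc ∫ ω, B.indicator (fun ω => h (noisyStep D α (X ω) (ξ ω))) ω ∂P
      = ∫ ω, g (Y ω, ξ ω) ∂P := integral_congr_ae (Eventually.of_forall fun ω => by
        simp only [e1]
        by_cases hω : ω ∈ B <;> simp [hω])
    _ = ∫ q, g q ∂(P.map fun ω => (Y ω, ξ ω)) :=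
        (integral_map (hYm'.prodMk hξ).aemeasurable hgm.aestronglyMeasurable).symm
    _ = ∫ y, ∫ z, g (y, z) ∂(isoGaussian E s) ∂(P.map Y) := by rw [hprod, integral_prod _ hgi]
    _ = ∫ ω, ∫ z, g (Y ω, z) ∂(isoGaussian E s) ∂P :=
        integral_map hYm'.aemeasurable hgi.integral_prod_left.aestronglyMeasurable
    _ = _ := integral_congr_ae (Eventually.of_forall fun ω => by
        simp only [e1]
        by_cases hω : ω ∈ B <;> simp [hω])

/-- The probability that noisy gradient descent avoids `S` at times `1, …, K`. -/
theorem measureReal_avoid_eq {Ω : Type*} [mΩ : MeasurableSpace Ω] {P : Measure Ω}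
    [IsProbabilityMeasure P] (hD : Continuous D) (hS : MeasurableSet S)
    {ℱ : ℕ → MeasurableSpace Ω} (hmono : Monotone ℱ) (hℱ : ∀ k, ℱ k ≤ mΩ)
    {X ξ : ℕ → Ω → E} (hX : ∀ k, Measurable[ℱ k] (X k)) (hξ : ∀ k, Measurable (ξ k))
    (hlaw : ∀ k, P.map (ξ k) = isoGaussian E s)
    (hind : ∀ k, Indep (ℱ k) (MeasurableSpace.comap (ξ k) inferInstance) P)
    {x₀ : E} (hX0 : ∀ ω, X 0 ω = x₀)
    (hstep : ∀ k ω, X (k + 1) ω = noisyStep D α (X k ω) (ξ k ω)) (K : ℕ) :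
    P.real {ω | ∀ k, 0 < k → k ≤ K → X k ω ∉ S}
      = ∫ z, survival D α s S K (noisyStep D α x₀ z) ∂(isoGaussian E s) := by
  set B : ℕ → Set Ω := fun j => {ω | ∀ k, 0 < k → k ≤ j → X k ω ∉ S} with hB
  have hBm : ∀ j, MeasurableSet[ℱ j] (B j) := by
    intro j
    have e : B j = ⋂ k ∈ Finset.Icc 1 j, X k ⁻¹' Sᶜ := by
      ext ω
      simp only [hB, Set.mem_ofPred_eq, Set.mem_iInter, Finset.mem_Icc, Set.mem_preimage,
        Set.mem_compl_iff]
      exact ⟨fun h k hk => h k hk.1 hk.2, fun h k h1 h2 => h k ⟨h1, h2⟩⟩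
    rw [e]
    refine Finset.measurableSet_biInter _ fun k hk => ?_
    exact hmono (Finset.mem_Icc.1 hk).2 _ (hX k hS.compl)
  -- `B j` records avoidance at times `1, …, j`, and `survival` takes over at time `j + 1`. Each
  -- induction step moves one constraint from the latter to the former.
  have key : ∀ i j, ∫ ω, (B j).indicator (fun ω => survival D α s S i (X (j + 1) ω)) ω ∂P
      = P.real (B (j + i)) := by
    intro i
    induction i with
    | zero =>
      intro j
      simp only [survival, add_zero]
      rw [integral_indicator_const _ (hℱ j _ (hBm j)), smul_eq_mul, mul_one]
    | succ i ih =>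
      intro j
      rw [show j + (i + 1) = (j + 1) + i by ring, ← ih (j + 1)]
      simp only [hstep (j + 1)]
      rw [integral_indicator_comp_noisyStep hD (hℱ (j + 1)) (hX (j + 1)) (hξ (j + 1))
        (hlaw (j + 1)) (hind (j + 1)) (hBm (j + 1)) (measurable_survival hD hS i)
        (survival_mem_Icc i)]
      refine integral_congr_ae (Eventually.of_forall fun ω => ?_)
      have hmem : ω ∈ B (j + 1) ↔ ω ∈ B j ∧ X (j + 1) ω ∉ S := by
        simp only [hB, Set.mem_ofPred_eq]
        constructor
        · exact fun h => ⟨fun k h1 h2 => h k h1 (by omega), h _ (by omega) le_rfl⟩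
        · rintro ⟨h, h'⟩ k h1 h2
          rcases Nat.lt_or_ge j k with hk | hk
          · rwa [show k = j + 1 by omega]
          · exact h k h1 hk
      by_cases h1 : ω ∈ B j <;> by_cases h2 : X (j + 1) ω ∈ S <;>
        simp [Set.indicator, survival, hmem, h1, h2]
  have h0 := key K 0
  have hu : B 0 = Set.univ := by
    ext ω
    simp only [hB, Set.mem_ofPred_eq, Set.mem_univ, iff_true]
    intro k h1 h2
    omega
  rw [zero_add K] at h0
  rw [← h0]
  simp only [hstep 0]
  rw [integral_indicator_comp_noisyStep hD (hℱ 0) (hX 0) (hξ 0) (hlaw 0) (hind 0) (hBm 0)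
    (measurable_survival hD hS K) (survival_mem_Icc K), hu]
  simp [hX0]

end Survival

/-! ### Joint law and independence of the block perturbations -/

section Noise

variable {m n : ℕ}

theorem charFun_multivariateGaussian_smul_one {c : ℝ} (hc : 0 ≤ c)
    (t : EuclideanSpace ℝ (Fin n)) :
    charFun (multivariateGaussian (0 : EuclideanSpace ℝ (Fin n))
      (c • (1 : Matrix (Fin n) (Fin n) ℝ))) t = Complex.exp (-(c * ‖t‖ ^ 2 / 2 : ℝ)) := by
  rw [charFun_multivariateGaussian (Matrix.PosSemidef.one.smul hc)]
  congr 1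
  rw [Matrix.smul_mulVec, Matrix.one_mulVec, dotProduct_smul, EuclideanSpace.real_norm_sq_eq]
  simp [dotProduct, pow_two]

theorem map_toLp_eq_isoGaussian {Ω : Type*} [MeasurableSpace Ω] {P : Measure Ω}
    [IsProbabilityMeasure P] {ν : Fin m → Ω → EuclideanSpace ℝ (Fin n)}
    (hν : ∀ i, Measurable (ν i)) {s : ℝ}
    (hlaw : ∀ i, P.map (ν i) = multivariateGaussian 0
      (s ^ 2 • (1 : Matrix (Fin n) (Fin n) ℝ))) (hind : iIndepFun ν P) :
    P.map (fun ω => (WithLp.toLp 2 (fun i => ν i ω) : Blocks m n)) = isoGaussian (Blocks m n) s := by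
  have hm : Measurable (fun ω i => ν i ω) := measurable_pi_lambda _ hν
  have h1 : P.map (fun ω => (WithLp.toLp 2 (fun i => ν i ω) : Blocks m n))
      = (Measure.pi fun _ : Fin m => multivariateGaussian (0 : EuclideanSpace ℝ (Fin n))
        (s ^ 2 • (1 : Matrix (Fin n) (Fin n) ℝ))).map (WithLp.toLp 2) := by
    have h2 := (iIndepFun_iff_map_fun_eq_pi_map fun i => (hν i).aemeasurable).1 hind
    simp only [hlaw] at h2
    rw [← h2, Measure.map_map (by fun_prop) hm]
    rfl
  have hp : IsProbabilityMeasure (P.map (fun ω => (WithLp.toLp 2 (fun i => ν i ω) : Blocks m n))) :=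
    Measure.isProbabilityMeasure_map ((by fun_prop : Measurable (WithLp.toLp 2 :
      (Fin m → EuclideanSpace ℝ (Fin n)) → Blocks m n)).comp hm).aemeasurable
  refine Measure.ext_of_charFun (funext fun t => ?_)
  rw [h1, charFun_pi, charFun_isoGaussian, PiLp.norm_sq_eq_of_L2]
  simp_rw [charFun_multivariateGaussian_smul_one (sq_nonneg s)]
  rw [← Complex.exp_sum]
  congr 1
  push_cast
  rw [Finset.sum_neg_distrib, ← Finset.sum_div, ← Finset.mul_sum]

theorem noisyGD_succ (Ψ : Blocks m n → ℝ) (α : ℝ) (ν : ℕ → Fin m → EuclideanSpace ℝ (Fin n))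
    (k : ℕ) : noisyGD Ψ α ν (k + 1)
      = noisyStep (gradient Ψ) α (noisyGD Ψ α ν k) (WithLp.toLp 2 (ν k)) := rfl

/-- The probability that `noisyGD` avoids `S` at times `1, …, K`, as a survival probability. -/
theorem measureReal_noisyGD_avoid_eq {Ω : Type*} [mΩ : MeasurableSpace Ω] {P : Measure Ω}
    [IsProbabilityMeasure P] {Ψ : Blocks m n → ℝ} (hD : Continuous (gradient Ψ)) {α s : ℝ}
    {S : Set (Blocks m n)} (hS : MeasurableSet S)
    {ν : ℕ → Fin m → Ω → EuclideanSpace ℝ (Fin n)} (hν : ∀ k i, Measurable (ν k i))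
    (hlaw : ∀ k i, P.map (ν k i) = multivariateGaussian 0
      (s ^ 2 • (1 : Matrix (Fin n) (Fin n) ℝ)))
    (hind : iIndepFun (fun q : ℕ × Fin m => ν q.1 q.2) P) (K : ℕ) :
    P.real {ω | ∀ k, 0 < k → k ≤ K → noisyGD Ψ α (fun j i => ν j i ω) k ∉ S}
      = ∫ z, survival (gradient Ψ) α s S K (noisyStep (gradient Ψ) α 0 z)
        ∂(isoGaussian (Blocks m n) s) := by
  set c : ℕ × Fin m → MeasurableSpace Ω := fun q =>
    MeasurableSpace.comap (ν q.1 q.2) inferInstance with hc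
  have hcm : ∀ q, c q ≤ mΩ := fun q => (hν q.1 q.2).comap_le
  -- The inequality is strict: `ℱ k` contains the noise that determines the `k`-th iterate, but is
  -- independent of the noise used to leave it.
  set ℱ : ℕ → MeasurableSpace Ω := fun k => ⨆ q ∈ {q : ℕ × Fin m | q.1 < k}, c q with hℱ
  have hmono : Monotone ℱ := fun j k hjk =>
    biSup_mono fun q (hq : q.1 < j) => (lt_of_lt_of_le hq hjk : q.1 < k)
  have hle : ∀ k, ℱ k ≤ mΩ := fun k => iSup₂_le fun q _ => hcm q
  have htoLp : Measurable (WithLp.toLp 2 : (Fin m → EuclideanSpace ℝ (Fin n)) → Blocks m n) := by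
    fun_prop
  have hblock : ∀ (A : Set (ℕ × Fin m)) (k : ℕ), (∀ i, (k, i) ∈ A) →
      Measurable[⨆ q ∈ A, c q] (fun ω => (WithLp.toLp 2 (fun i => ν k i ω) : Blocks m n)) := by
    intro A k hA
    refine htoLp.comp (@measurable_pi_lambda _ _ _ (_) _ _ fun i => ?_)
    exact (comap_measurable (ν k i)).mono (le_biSup c (hA i)) le_rfl
  have hX : ∀ k, Measurable[ℱ k] (fun ω => noisyGD Ψ α (fun j i => ν j i ω) k) := by
    intro k
    induction k with
    | zero => exact measurable_const
    | succ k ih =>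
      simp only [noisyGD_succ]
      exact (measurable_noisyStep hD).comp ((ih.mono (hmono (Nat.le_succ k)) le_rfl).prodMk
        (hblock _ k fun i => Nat.lt_succ_self k))
  refine measureReal_avoid_eq (X := fun k ω => noisyGD Ψ α (fun j i => ν j i ω) k)
    (ξ := fun k ω => WithLp.toLp 2 (fun i => ν k i ω)) hD hS hmono hle hX
    (fun k => htoLp.comp (measurable_pi_lambda _ (hν k)))
    (fun k => map_toLp_eq_isoGaussian (hν k) (hlaw k) ?_) (fun k => ?_) (fun ω => rfl)
    (fun k ω => rfl) K
  · exact hind.precomp (g := fun i => (k, i)) fun i j hij => (Prod.mk.inj hij).2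
  · have hdisj : Disjoint {q : ℕ × Fin m | q.1 < k} {q : ℕ × Fin m | q.1 = k} :=
      Set.disjoint_left.2 fun q (h1 : q.1 < k) (h2 : q.1 = k) => h1.ne h2
    exact indep_of_indep_of_le_right (indep_iSup_of_disjoint hcm hind hdisj)
      (hblock _ k fun i => rfl).comap_le

end Noise

/-! ### Gradients, Hessians and curvature -/

section Calculus

variable {E F : Type*} [NormedAddCommGroup E] [InnerProductSpace ℝ E] [CompleteSpace E]
  [NormedAddCommGroup F] [InnerProductSpace ℝ F] [CompleteSpace F]

theorem norm_image_sub_sub_le_of_fderiv {V W : Type*} [NormedAddCommGroup V] [NormedSpace ℝ V]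
    [NormedAddCommGroup W] [NormedSpace ℝ W] {g : V → W} (hg : Differentiable ℝ g) {K : ℝ}
    (hK : 0 ≤ K) {x : V} (h : ∀ z, ‖fderiv ℝ g z - fderiv ℝ g x‖ ≤ K * ‖z - x‖) (y : V) :
    ‖g y - g x - fderiv ℝ g x (y - x)‖ ≤ K * ‖y - x‖ ^ 2 := by
  have := (convex_closedBall x ‖y - x‖).norm_image_sub_le_of_norm_hasFDerivWithin_le'
    (f := g) (f' := fderiv ℝ g) (φ := fderiv ℝ g x) (C := K * ‖y - x‖) (x := x) (y := y)
    (fun z _ => (hg z).hasFDerivAt.hasFDerivWithinAt) (fun z hz => (h z).trans (by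
      rw [Metric.mem_closedBall, dist_eq_norm] at hz
      gcongr)) (by simp) (by simp [dist_eq_norm])
  rwa [mul_assoc, ← pow_two] at this

theorem gradient_eq_toDual_symm_comp (f : E → ℝ) :
    gradient f = (InnerProductSpace.toDual ℝ E).symm ∘ fderiv ℝ f := rfl

theorem contDiff_gradient {f : E → ℝ} (hf : ContDiff ℝ 2 f) : ContDiff ℝ 1 (gradient f) := by
  rw [gradient_eq_toDual_symm_comp]
  exact (InnerProductSpace.toDual ℝ E).symm.contDiff.comp (hf.fderiv_right (by norm_num))

theorem hasFDerivAt_gradient {f : E → ℝ} (hf : ContDiff ℝ 2 f) (x : E) :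
    HasFDerivAt (gradient f) (hessian f x) x :=
  ((contDiff_gradient hf).differentiable one_ne_zero x).hasFDerivAt

theorem inner_hessian_apply {f : E → ℝ} (hf : ContDiff ℝ 2 f) (x u w : E) :
    inner ℝ (hessian f x u) w = fderiv ℝ (fderiv ℝ f) x u w := by
  have h2 : DifferentiableAt ℝ (fderiv ℝ f) x :=
    (hf.fderiv_right (m := 1) (by norm_num)).differentiable one_ne_zero x
  have h3 := (InnerProductSpace.toDual ℝ E).symm.toContinuousLinearEquiv.toContinuousLinearMap
    |>.hasFDerivAt.comp x h2.hasFDerivAt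
  have h4 : hessian f x = _ := HasFDerivAt.fderiv h3
  rw [h4]
  simp

theorem isSymmetric_hessian {f : E → ℝ} (hf : ContDiff ℝ 2 f) (x : E) :
    (hessian f x : E →ₗ[ℝ] E).IsSymmetric := by
  intro u w
  have := (hf.contDiffAt (x := x)).isSymmSndFDerivAt (by simp) u w
  simp only [ContinuousLinearMap.coe_coe]
  rw [inner_hessian_apply hf, this, ← inner_hessian_apply hf, real_inner_comm]

/-- The mean value inequality on a ball gives the descent inequality with `L` in place of the sharp
`L / 2`, which affects only the size of the step size threshold. -/
theorem isSmoothObjective_of_contDiff {f : E → ℝ} (hf : ContDiff ℝ 2 f) {L : ℝ≥0}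
    (hL : LipschitzWith L (gradient f)) {b : ℝ} (hb : ∀ x, b ≤ f x) :
    IsSmoothObjective f (gradient f) L b where
  continuous := hf.continuous
  lipschitz := hL
  lower := hb
  descent x y := by
    have h := norm_image_sub_sub_le_of_fderiv (hf.differentiable two_ne_zero) L.coe_nonneg
      (x := x) (fun z => by
        have := hL.dist_le_mul z x
        rw [dist_eq_norm, dist_eq_norm, gradient_eq_toDual_symm_comp, Function.comp_apply,
          Function.comp_apply, ← map_sub, LinearIsometryEquiv.norm_map] at this
        exact this) y
    rw [← inner_gradient_left, Real.norm_eq_abs] at h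
    linarith [(abs_le.1 h).2]

theorem norm_gradient_sub_sub_le {f : E → ℝ} (hf : ContDiff ℝ 2 f) {K : ℝ≥0}
    (hK : LipschitzWith K (hessian f)) (x y : E) :
    ‖gradient f y - gradient f x - hessian f x (y - x)‖ ≤ K * ‖y - x‖ ^ 2 :=
  norm_image_sub_sub_le_of_fderiv ((contDiff_gradient hf).differentiable one_ne_zero)
    K.coe_nonneg (fun z => by
      have := hK.dist_le_mul z x
      rwa [dist_eq_norm, dist_eq_norm] at this) y

/-- Negative curvature yields an escape direction, namely a minimal eigenvector of the Hessian. -/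
theorem exists_isEscapeDirection [FiniteDimensional ℝ E] {f : E → ℝ} (hf : ContDiff ℝ 2 f)
    {L K : ℝ≥0} (hL : LipschitzWith L (gradient f)) (hK : LipschitzWith K (hessian f)) {γ : ℝ}
    {x u : E} (hu : inner ℝ (hessian f x u) u < -γ * ‖u‖ ^ 2) :
    ∃ v μ, IsEscapeDirection (gradient f) L K γ x v μ := by
  have hu0 : u ≠ 0 := by
    rintro rfl
    simp at hu
  have : Nontrivial E := ⟨u, 0, hu0⟩
  have hHL : ‖hessian f x‖ ≤ L := norm_fderiv_le_of_lipschitz ℝ hL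
  have hray : ∀ y : E, |inner ℝ (hessian f x y) y| ≤ L * ‖y‖ ^ 2 := fun y => by
    calc |inner ℝ (hessian f x y) y| ≤ ‖hessian f x y‖ * ‖y‖ := abs_real_inner_le_norm _ _
      _ ≤ (L * ‖y‖) * ‖y‖ := by
          gcongr
          exact (hessian f x).le_of_opNorm_le hHL y
      _ = _ := by ring
  -- The infimum of the Rayleigh quotient is an eigenvalue, and the test vector `u` pushes it to
  -- `-γ` or below.
  have heig := (isSymmetric_hessian hf x).hasEigenvalue_iInf_of_finiteDimensional
  simp only [RCLike.re_to_real, ContinuousLinearMap.coe_coe, RCLike.ofReal_real_eq_id, id] at heig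
  set μ := ⨅ y : { y : E // y ≠ 0 }, inner ℝ (hessian f x y) (y : E) / ‖(y : E)‖ ^ 2 with hμ
  have hbdd : BddBelow (Set.range fun y : { y : E // y ≠ 0 } =>
      inner ℝ (hessian f x y) (y : E) / ‖(y : E)‖ ^ 2) := by
    refine ⟨-L, ?_⟩
    rintro _ ⟨y, rfl⟩
    have hy : 0 < ‖(y : E)‖ ^ 2 := by
      have := norm_pos_iff.2 y.2
      positivity
    simp only
    rw [le_div_iff₀ hy]
    linarith [(abs_le.1 (hray y)).1]
  have hμu : μ ≤ -γ := by
    refine (ciInf_le hbdd ⟨u, hu0⟩).trans ?_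
    have hy : 0 < ‖u‖ ^ 2 := by
      have := norm_pos_iff.2 hu0
      positivity
    rw [div_le_iff₀ hy]
    exact hu.le
  obtain ⟨w, hw⟩ := heig.exists_hasEigenvector
  have hw0 : ‖w‖ ≠ 0 := norm_ne_zero_iff.2 hw.2
  have hHw : hessian f x w = μ • w := hw.apply_eq_smul
  set v := ‖w‖⁻¹ • w with hv
  have hHv : hessian f x v = μ • v := by rw [hv, map_smul, hHw, smul_comm]
  have hv1 : ‖v‖ = 1 := by
    rw [hv, norm_smul, norm_inv, norm_norm, inv_mul_cancel₀ hw0]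
  refine ⟨v, μ, hv1, hμu, ?_, fun y => ?_⟩
  · have := hray v
    rwa [hHv, inner_smul_left, real_inner_self_eq_norm_sq, hv1, one_pow, mul_one, mul_one] at this
  · have e : inner ℝ v (gradient f y) - affineModel (gradient f) x v μ y
        = inner ℝ v (gradient f y - gradient f x - hessian f x (y - x)) := by
      have hs : inner ℝ v (hessian f x (y - x)) = μ * inner ℝ v (y - x) := by
        have := isSymmetric_hessian hf x v (y - x)
        simp only [ContinuousLinearMap.coe_coe] at this
        rw [← this, hHv, inner_smul_left]
        rfl
      rw [affineModel, inner_sub_right v (gradient f y - gradient f x), hs,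
        inner_sub_right v (gradient f y)]
      ring
    rw [e]
    refine (abs_real_inner_le_norm _ _).trans ?_
    rw [hv1, one_mul]
    exact norm_gradient_sub_sub_le hf hK x y

/-- A function with constant Hessian that is bounded below is convex. -/
theorem inner_hessian_nonneg_of_bddBelow {f : E → ℝ} (hf : ContDiff ℝ 2 f)
    (hK : LipschitzWith 0 (hessian f)) {b : ℝ} (hb : ∀ x, b ≤ f x) (x u : E) :
    0 ≤ inner ℝ (hessian f x u) u := by
  set q := inner ℝ (hessian f x u) u with hq
  set p := inner ℝ (gradient f x) u with hp
  have hgrad : ∀ y, gradient f y = gradient f x + hessian f x (y - x) := fun y => by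
    have := norm_gradient_sub_sub_le hf hK x y
    simp only [NNReal.coe_zero, zero_mul, norm_le_zero_iff] at this
    rw [sub_sub, sub_eq_zero] at this
    exact this
  have hder : ∀ t : ℝ, HasDerivAt (fun t : ℝ => f (x + t • u) - t * p - t ^ 2 / 2 * q) 0 t := by
    intro t
    have h1 : HasDerivAt (fun t : ℝ => x + t • u) u t := by
      simpa using ((hasDerivAt_id t).smul_const u).const_add x
    have h2 := ((hf.differentiable two_ne_zero (x + t • u)).hasFDerivAt).comp_hasDerivAt t h1
    rw [← inner_gradient_left, hgrad, add_sub_cancel_left, map_smul, inner_add_left,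
      inner_smul_left, ← hq, ← hp] at h2
    have h3 := (h2.sub ((hasDerivAt_id t).mul_const p)).sub
      ((((hasDerivAt_id t).pow 2).div_const 2).mul_const q)
    refine h3.congr_deriv ?_
    simp
  have hconst : ∀ t : ℝ, f (x + t • u) = f x + t * p + t ^ 2 / 2 * q := fun t => by
    have := is_const_of_deriv_eq_zero (fun t => (hder t).differentiableAt)
      (fun t => (hder t).deriv) t 0
    simp only [zero_smul, add_zero] at this
    linarith
  by_contra hneg
  rw [not_le] at hneg
  have hfb := hb x
  -- Averaging the values at `x + t • u` and `x - t • u` removes the linear term, and this `t` puts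
  -- the average at `b - 1 / 2`.
  set t := √((2 * (f x - b) + 1) / (-q)) with ht
  have ht2 : t ^ 2 = (2 * (f x - b) + 1) / (-q) :=
    Real.sq_sqrt (div_nonneg (by linarith) (by linarith))
  have ht3 : t ^ 2 * q = -(2 * (f x - b) + 1) := by
    rw [ht2, div_neg, neg_mul, div_mul_cancel₀ _ hneg.ne]
  have h1 := hb (x + t • u)
  have h2 := hb (x + (-t) • u)
  rw [hconst] at h1 h2
  nlinarith

theorem neg_le_lambdaMin {T : E →L[ℝ] E} {δ : ℝ} (hδ : 0 ≤ δ)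
    (h : ∀ u, -δ * ‖u‖ ^ 2 ≤ inner ℝ (T u) u) : -δ ≤ lambdaMin T := by
  rw [lambdaMin]
  -- With no eigenvalues, `sInf ∅ = 0`, and `0 ≤ δ` settles the case.
  rcases Set.eq_empty_or_nonempty {μ : ℝ | Module.End.HasEigenvalue (T : E →ₗ[ℝ] E) μ} with he | hne
  · rw [he, Real.sInf_empty]
    linarith
  · refine le_csInf hne fun μ hμ => ?_
    obtain ⟨w, hw⟩ := Module.End.HasEigenvalue.exists_hasEigenvector hμ
    have hTw : T w = μ • w := hw.apply_eq_smul
    have h1 := h w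
    rw [hTw, inner_smul_left, real_inner_self_eq_norm_sq] at h1
    have h2 : 0 < ‖w‖ ^ 2 := by
      have := norm_pos_iff.2 hw.2
      positivity
    exact le_of_mul_le_mul_right h1 h2

/-! ### Sums of functions composed with affine maps -/

section Composite

variable {ι : Type*} [Fintype ι] {f : ι → F → ℝ} {B : ι → E →L[ℝ] F}

theorem contDiff_sum_comp_affine (hf : ∀ i, ContDiff ℝ 2 (f i)) (b : ι → F) :
    ContDiff ℝ 2 (fun x => ∑ i, f i (b i + B i x)) :=
  ContDiff.sum fun i _ => (hf i).comp (contDiff_const.add (B i).contDiff)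

theorem gradient_sum_comp_affine (hf : ∀ i, ContDiff ℝ 2 (f i)) (b : ι → F) :
    gradient (fun x => ∑ i, f i (b i + B i x))
      = fun x => ∑ i, (B i).adjoint (gradient (f i) (b i + B i x)) := by
  refine gradient_eq fun x => ?_
  rw [hasGradientAt_iff_hasFDerivAt]
  have h1 : HasFDerivAt (fun x => ∑ i, f i (b i + B i x))
      (∑ i, (fderiv ℝ (f i) (b i + B i x)).comp (B i)) x :=
    HasFDerivAt.fun_sum fun i _ => ((hf i).differentiable two_ne_zero _).hasFDerivAt.comp x
      ((B i).hasFDerivAt.const_add (b i))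
  refine h1.congr_fderiv ?_
  ext u
  simp [ContinuousLinearMap.adjoint_inner_left, inner_gradient_left]

theorem hessian_sum_comp_affine (hf : ∀ i, ContDiff ℝ 2 (f i)) (b : ι → F) :
    hessian (fun x => ∑ i, f i (b i + B i x))
      = fun x => ∑ i, (B i).adjoint ∘L (hessian (f i) (b i + B i x)) ∘L (B i) := by
  funext x
  rw [hessian, gradient_sum_comp_affine hf b]
  refine HasFDerivAt.fderiv (HasFDerivAt.fun_sum fun i _ => ?_)
  exact (B i).adjoint.hasFDerivAt.comp x ((hasFDerivAt_gradient (hf i) _).comp x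
    ((B i).hasFDerivAt.const_add (b i)))

theorem norm_adjoint_le (T : E →L[ℝ] F) : ‖T.adjoint‖ ≤ ‖T‖ :=
  (LinearIsometryEquiv.norm_map _ T).le

theorem norm_affine_sub_le (T : E →L[ℝ] F) (c : F) (x y : E) :
    ‖(c + T x) - (c + T y)‖ ≤ ‖T‖ * ‖x - y‖ := by
  rw [add_sub_add_left_eq_sub, ← map_sub]
  exact T.le_opNorm _

theorem lipschitzWith_gradient_sum_comp_affine (hf : ∀ i, ContDiff ℝ 2 (f i)) (b : ι → F)
    {Lg : ι → ℝ≥0} (hLg : ∀ i, LipschitzWith (Lg i) (gradient (f i))) :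
    LipschitzWith (∑ i, ‖B i‖₊ ^ 2 * Lg i) (gradient (fun x => ∑ i, f i (b i + B i x))) := by
  rw [gradient_sum_comp_affine hf b]
  refine LipschitzWith.of_dist_le_mul fun x y => ?_
  rw [dist_eq_norm, dist_eq_norm, ← Finset.sum_sub_distrib]
  push_cast
  rw [Finset.sum_mul]
  refine norm_sum_le_of_le _ fun i _ => ?_
  rw [← map_sub]
  have h1 := (hLg i).dist_le_mul (b i + B i x) (b i + B i y)
  rw [dist_eq_norm, dist_eq_norm] at h1
  calc _ ≤ ‖B i‖ * ‖gradient (f i) (b i + B i x) - gradient (f i) (b i + B i y)‖ :=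
        (B i).adjoint.le_of_opNorm_le (norm_adjoint_le _) _
    _ ≤ ‖B i‖ * (Lg i * (‖B i‖ * ‖x - y‖)) := by
        gcongr
        refine h1.trans ?_
        gcongr
        exact norm_affine_sub_le _ _ _ _
    _ = _ := by ring

theorem lipschitzWith_hessian_sum_comp_affine (hf : ∀ i, ContDiff ℝ 2 (f i)) (b : ι → F)
    {LH : ι → ℝ≥0} (hLH : ∀ i, LipschitzWith (LH i) (hessian (f i))) :
    LipschitzWith (∑ i, ‖B i‖₊ ^ 3 * LH i) (hessian (fun x => ∑ i, f i (b i + B i x))) := by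
  rw [hessian_sum_comp_affine hf b]
  refine LipschitzWith.of_dist_le_mul fun x y => ?_
  rw [dist_eq_norm, dist_eq_norm, ← Finset.sum_sub_distrib]
  push_cast
  rw [Finset.sum_mul]
  refine norm_sum_le_of_le _ fun i _ => ?_
  rw [← ContinuousLinearMap.comp_sub, ← ContinuousLinearMap.sub_comp]
  have h1 := (hLH i).dist_le_mul (b i + B i x) (b i + B i y)
  rw [dist_eq_norm, dist_eq_norm] at h1
  calc _ ≤ ‖(B i).adjoint‖ * (‖hessian (f i) (b i + B i x) - hessian (f i) (b i + B i y)‖ * ‖B i‖) :=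
        (ContinuousLinearMap.opNorm_comp_le _ _).trans (by
          gcongr
          exact ContinuousLinearMap.opNorm_comp_le _ _)
    _ ≤ ‖B i‖ * (LH i * (‖B i‖ * ‖x - y‖) * ‖B i‖) := by
        gcongr
        · exact norm_adjoint_le _
        · refine h1.trans ?_
          gcongr
          exact norm_affine_sub_le _ _ _ _
    _ = _ := by ring

end Composite

end Calculus

/-! ### Positivity of the constants and the set of second-order points -/

theorem specNorm_lapSqrt_pos {m : ℕ} (hm : 2 ≤ m) (G : SimpleGraph (Fin m)) [DecidableRel G.Adj]
    (hG : G.Connected) : 0 < specNorm (lapSqrt G) := by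
  refine lt_of_le_of_ne (norm_nonneg _) fun h => ?_
  have h1 : lapSqrt G = 0 := by
    have := norm_eq_zero.1 h.symm
    exact (EmbeddingLike.map_eq_zero_iff).1 this
  have h2 : G.lapMatrix ℝ = 0 := by rw [← lapSqrt_mul_self, h1, zero_mul]
  have : Nontrivial (Fin m) := Fin.nontrivial_iff_two_le.2 hm
  set i : Fin m := ⟨0, by omega⟩
  -- Connectedness on at least two vertices makes the diagonal of the Laplacian nonzero.
  have h3 := hG.preconnected.degree_pos_of_nontrivial i
  have h4 := congrFun (congrFun h2 i) i
  simp [SimpleGraph.lapMatrix, SimpleGraph.degMatrix] at h4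
  omega

/-- A coercive function does not have a constant gradient. -/
theorem lipschitz_gradient_ne_zero_of_coercive {E : Type*} [NormedAddCommGroup E]
    [InnerProductSpace ℝ E] [CompleteSpace E] [Nontrivial E] {f : E → ℝ}
    (hf : Differentiable ℝ f) {K : ℝ≥0} (hK : LipschitzWith K (gradient f))
    (hcoer : Tendsto f (cocompact E) atTop) : K ≠ 0 := by
  rintro rfl
  have hconst : ∀ x, gradient f x = gradient f 0 := fun x => by
    have := hK.dist_le_mul x 0
    rw [NNReal.coe_zero, zero_mul] at this
    exact dist_le_zero.1 this
  have hder : ∀ x, HasFDerivAt (fun x => f x - innerSL ℝ (gradient f 0) x) 0 x := fun x => by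
    have h1 := (hf x).hasFDerivAt.sub (innerSL ℝ (gradient f 0)).hasFDerivAt
    refine h1.congr_fderiv ?_
    ext u
    rw [sub_apply, innerSL_apply_apply, ← inner_gradient_left, hconst x]
    simp
  have haff : ∀ x, f x = f 0 + inner ℝ (gradient f 0) x := fun x => by
    have := is_const_of_fderiv_eq_zero (𝕜 := ℝ) (fun x => (hder x).differentiableAt)
      (fun x => (hder x).fderiv) x 0
    simp only [innerSL_apply_apply, inner_zero_right] at this
    linarith
  have : NoncompactSpace E := NormedSpace.noncompactSpace ℝ E
  have hneg : Tendsto (fun x : E => f (-x)) (cocompact E) atTop :=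
    hcoer.comp (Homeomorph.neg E).isClosedEmbedding.tendsto_cocompact
  -- An affine function cannot exceed its value at `0` at both `x` and `-x`.
  obtain ⟨x, hx⟩ := ((hcoer.eventually_gt_atTop (f 0)).and
    (hneg.eventually_gt_atTop (f 0))).exists
  rw [haff x, haff (-x), inner_neg_right] at hx
  linarith [hx.1, hx.2]

theorem auxGradLip_pos {m n : ℕ} (hm : 2 ≤ m) (hn : 1 ≤ n) (G : SimpleGraph (Fin m))
    [DecidableRel G.Adj] (hG : G.Connected) {f : Fin m → EuclideanSpace ℝ (Fin n) → ℝ}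
    (hf : ∀ i, ContDiff ℝ 2 (f i)) {Lg : Fin m → ℝ≥0}
    (hLg : ∀ i, LipschitzWith (Lg i) (gradient (f i)))
    (hcoer : ∀ i, Tendsto (f i) (cocompact (EuclideanSpace ℝ (Fin n))) atTop) :
    0 < auxGradLip G Lg := by
  have h1 := specNorm_lapSqrt_pos hm G hG
  have : Nonempty (Fin n) := ⟨⟨0, hn⟩⟩
  set i : Fin m := ⟨0, by omega⟩
  have h2 : 0 < Lg i := pos_iff_ne_zero.2 (lipschitz_gradient_ne_zero_of_coercive
    ((hf i).differentiable two_ne_zero) (hLg i) (hcoer i))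
  have h3 : 0 < Finset.univ.sup Lg := h2.trans_le (Finset.le_sup (Finset.mem_univ i))
  exact mul_pos (pow_pos h1 2) (NNReal.coe_pos.2 h3)

/-- The `i`-th block of the action of `A ⊗ Iₙ`. -/
noncomputable def blockCLM {m : ℕ} (n : ℕ) (A : Matrix (Fin m) (Fin m) ℝ) (i : Fin m) :
    Blocks m n →L[ℝ] EuclideanSpace ℝ (Fin n) :=
  ∑ j, A i j • PiLp.proj 2 (fun _ : Fin m => EuclideanSpace ℝ (Fin n)) j

theorem auxFun_eq {m n : ℕ} (f : Fin m → EuclideanSpace ℝ (Fin n) → ℝ)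
    (G : SimpleGraph (Fin m)) [DecidableRel G.Adj] (θ₀ : Blocks m n) :
    auxFun f G θ₀ = fun x => ∑ i, f i (θ₀ i + blockCLM n (lapSqrt G) i x) := by
  funext x
  simp [auxFun, objective, kronAct, blockCLM]

theorem bddBelow_range_of_coercive {E : Type*} [TopologicalSpace E] [Nonempty E] {f : E → ℝ}
    (hf : Continuous f) (hcoer : Tendsto f (cocompact E) atTop) : BddBelow (Set.range f) := by
  obtain ⟨x, hx⟩ := hf.exists_forall_le hcoer
  exact ⟨f x, by rintro _ ⟨y, rfl⟩; exact hx y⟩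

/-- The points with gradient at most `ε` and curvature at least `-δ`. -/
def secondOrderPoints {E : Type*} [NormedAddCommGroup E] [InnerProductSpace ℝ E]
    [CompleteSpace E] (f : E → ℝ) (ε δ : ℝ) : Set E :=
  {x | ‖gradient f x‖ ≤ ε ∧ ∀ u, -δ * ‖u‖ ^ 2 ≤ inner ℝ (hessian f x u) u}

/-- Phrasing curvature through the quadratic form makes the set an intersection of closed
conditions, hence measurable, without any regularity of `lambdaMin`. -/
theorem isClosed_secondOrderPoints {E : Type*} [NormedAddCommGroup E] [InnerProductSpace ℝ E]
    [CompleteSpace E] {f : E → ℝ} (hf : ContDiff ℝ 2 f) (ε δ : ℝ) :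
    IsClosed (secondOrderPoints f ε δ) := by
  have h1 : Continuous (gradient f) := (contDiff_gradient hf).continuous
  have h2 : Continuous (hessian f) := (contDiff_gradient hf).continuous_fderiv one_ne_zero
  have e : secondOrderPoints f ε δ = {x | ‖gradient f x‖ ≤ ε} ∩
      ⋂ u, {x | -δ * ‖u‖ ^ 2 ≤ inner ℝ (hessian f x u) u} := by
    ext x
    simp [secondOrderPoints]
  rw [e]
  exact (isClosed_le h1.norm continuous_const).inter (isClosed_iInter fun u =>
    isClosed_le continuous_const ((h2.clm_apply continuous_const).inner continuous_const))

end NLGD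

/-! ### Choice of constants and conclusion -/

theorem proposition5
    (m n : ℕ) (hm : 2 ≤ m) (hn : 1 ≤ n)
    (G : SimpleGraph (Fin m)) [DecidableRel G.Adj] (hG : G.Connected)
    (f : Fin m → EuclideanSpace ℝ (Fin n) → ℝ)
    (hf : ∀ i, ContDiff ℝ 2 (f i))
    (Lg LH : Fin m → ℝ≥0)
    (hLg : ∀ i, LipschitzWith (Lg i) (gradient (f i)))
    (hLH : ∀ i, LipschitzWith (LH i) (hessian (f i)))
    (hcoer : ∀ i, Tendsto (f i) (cocompact (EuclideanSpace ℝ (Fin n))) atTop)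
    (r : EuclideanSpace ℝ (Fin n))
    (εg : ℝ) (hεg : 0 < εg) (p : ℝ) (hp0 : 0 < p) (hp1 : p < 1) :
    ∃ αbar : ℝ, 0 < αbar ∧
      αbar ≤ min (1 / auxGradLip G Lg) (-(2 * Real.log p) / auxGradLip G Lg) ∧
      ∀ α : ℝ, 0 < α → α ≤ αbar →
      ∀ θ₀ : Blocks m n, ∑ i, θ₀ i = r → ∑ i, (⨅ θ, f i θ) < objective f θ₀ →
      ∀ (Ω : Type*) [MeasurableSpace Ω] (P : Measure Ω) [IsProbabilityMeasure P]
        (ν : ℕ → Fin m → Ω → EuclideanSpace ℝ (Fin n)),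
        (∀ k i, Measurable (ν k i)) →
        (∀ k i, P.map (ν k i) = multivariateGaussian 0
          ((εg ^ 2 / (12 * (m : ℝ) * (n : ℝ))) • (1 : Matrix (Fin n) (Fin n) ℝ))) →
        iIndepFun (fun q : ℕ × Fin m => ν q.1 q.2) P →
        1 - p ≤ P.real {ω | ∃ k : ℕ, 0 < k ∧
          k ≤ numIter f (auxFun f G θ₀) (auxGradLip G Lg) εg α ∧
          ‖gradient (auxFun f G θ₀)
            (noisyGD (auxFun f G θ₀) α (fun j i => ν j i ω) k)‖ ≤ εg ∧
          -Real.sqrt (εg * auxHessLip G LH) ≤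
            lambdaMin (hessian (auxFun f G θ₀)
              (noisyGD (auxFun f G θ₀) α (fun j i => ν j i ω) k))} := by
  have hA := auxGradLip_pos hm hn G hG hf hLg hcoer
  set A := auxGradLip G Lg
  set δ := √(εg * auxHessLip G LH) with hδ
  have hδ0 : 0 ≤ δ := Real.sqrt_nonneg _
  -- Any Lipschitz constants independent of `θ₀` will do here. The prescribed `auxGradLip` enters
  -- only through its positivity, the iteration count and the cap on `αbar`.
  set L : ℝ≥0 := ∑ i, ‖blockCLM n (lapSqrt G) i‖₊ ^ 2 * Lg i
  set K : ℝ≥0 := ∑ i, ‖blockCLM n (lapSqrt G) i‖₊ ^ 3 * LH i with hK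
  have hH0 : 0 ≤ auxHessLip G LH :=
    mul_nonneg (pow_nonneg (norm_nonneg _) 3) (NNReal.coe_nonneg _)
  set s := √(εg ^ 2 / (12 * (m : ℝ) * (n : ℝ))) with hs
  have hm0 : (0 : ℝ) < m := by exact_mod_cast (by omega : 0 < m)
  have hn0 : (0 : ℝ) < n := by exact_mod_cast hn
  have hs0 : 0 < s := Real.sqrt_pos.2 (by positivity)
  have hs2 : s ^ 2 = εg ^ 2 / (12 * (m : ℝ) * (n : ℝ)) := Real.sq_sqrt (by positivity)
  set M := noiseMoment (Blocks m n) s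
  have hM : 0 ≤ M := noiseMoment_nonneg s
  obtain ⟨γ, hγ0, hγ⟩ : ∃ γ : ℝ, 0 < γ ∧ (auxHessLip G LH = 0 ∨ γ = δ) := by
    rcases eq_or_lt_of_le hH0 with h | h
    · exact ⟨1, one_pos, Or.inl h.symm⟩
    · exact ⟨δ, Real.sqrt_pos.2 (by positivity), Or.inr rfl⟩
  obtain ⟨α₀, hα₀, hmain⟩ := exists_stepSize_survival (Blocks m n) L (LH := K) (γ := γ) (s := s)
    -- By the choice of `N` and `1 ≤ N`, the budget `Ψ 0 - b + L * α ^ 2 * M` is at most `(A * εg ^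
    -- 2 + L * M) * α ^ 2 * N`. Dividing by `p` in `c` makes the avoidance probability at most `p`.
    (c := (A * εg ^ 2 + L * M) / p) (ε := εg) K.coe_nonneg hγ0 hs0 (by positivity) hεg
  have hlog : 0 < -(2 * Real.log p) := by linarith [Real.log_neg hp0 hp1]
  refine ⟨min α₀ (min (1 / A) (-(2 * Real.log p) / A)), by positivity, min_le_right _ _,
    fun α hα hαle θ₀ _ hθ₀ Ω _ P _ ν hν hlaw hind => ?_⟩
  set Ψ := auxFun f G θ₀ with hΨ
  have hΨe : Ψ = fun x => ∑ i, f i (θ₀ i + blockCLM n (lapSqrt G) i x) := auxFun_eq f G θ₀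
  have hΨc : ContDiff ℝ 2 Ψ := by
    rw [hΨe]
    exact contDiff_sum_comp_affine hf _
  have hΨL : LipschitzWith L (gradient Ψ) := by
    rw [hΨe]
    exact lipschitzWith_gradient_sum_comp_affine hf _ hLg
  have hΨK : LipschitzWith K (hessian Ψ) := by
    rw [hΨe]
    exact lipschitzWith_hessian_sum_comp_affine hf _ hLH
  set b := ∑ i, ⨅ θ, f i θ with hb
  have hΨb : ∀ x, b ≤ Ψ x := fun x => by
    rw [hΨe]
    exact Finset.sum_le_sum fun i _ =>
      ciInf_le (bddBelow_range_of_coercive (hf i).continuous (hcoer i)) _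
  have hΨ0 : Ψ 0 = objective f θ₀ := by
    rw [hΨe]
    simp [objective]
  rw [← hΨ0] at hθ₀
  set S := secondOrderPoints Ψ εg δ with hS
  have hSm : MeasurableSet S := (isClosed_secondOrderPoints hΨc εg δ).measurableSet
  have hout : ∀ x ∉ S, εg < ‖gradient Ψ x‖ ∨
      ∃ v μ, IsEscapeDirection (gradient Ψ) L K γ x v μ := by
    intro x hx
    by_cases hg : εg < ‖gradient Ψ x‖
    · exact Or.inl hg
    have hex : ¬ ∀ u, -δ * ‖u‖ ^ 2 ≤ inner ℝ (hessian Ψ x u) u := fun h => hx ⟨not_lt.1 hg, h⟩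
    push Not at hex
    obtain ⟨u, hu⟩ := hex
    rcases hγ with h0 | rfl
    · have hsup : Finset.univ.sup LH = 0 := by
        rcases mul_eq_zero.1 h0 with h | h
        · exact absurd h (pow_pos (specNorm_lapSqrt_pos hm G hG) 3).ne'
        · exact_mod_cast h
      have hK0 : K = 0 := by
        refine Finset.sum_eq_zero fun i hi => ?_
        have : LH i = 0 := le_antisymm (hsup ▸ Finset.le_sup hi) zero_le
        rw [this, mul_zero]
      rw [hK0] at hΨK
      have := inner_hessian_nonneg_of_bddBelow hΨc hΨK hΨb x u
      have h2 : 0 ≤ δ * ‖u‖ ^ 2 := by positivity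
      linarith
    · exact Or.inr (exists_isEscapeDirection hΨc hΨL hΨK hu)
  set N := numIter f Ψ A εg α with hN
  have hprob := hmain α hα (hαle.trans (min_le_left _ _)) Ψ (gradient Ψ) b
    (isSmoothObjective_of_contDiff hΨc hΨL hΨb) S hSm hout N 0
  rw [← hs2] at hlaw
  rw [← measureReal_noisyGD_avoid_eq hΨL.continuous hSm hν hlaw hind N] at hprob
  set q := P.real {ω | ∀ k, 0 < k → k ≤ N → noisyGD Ψ α (fun j i => ν j i ω) k ∉ S} with hq
  have hden : 0 < A * εg ^ 2 * α ^ 2 := by positivity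
  have hN1 : (1 : ℝ) ≤ N := by
    have : 0 < N := Nat.ceil_pos.2 (div_pos (sub_pos.2 hθ₀) hden)
    exact_mod_cast this
  have hNle : Ψ 0 - b ≤ N * (A * εg ^ 2 * α ^ 2) := (div_le_iff₀ hden).1 (Nat.le_ceil _)
  have hqp : q ≤ p := by
    have h1 : 0 ≤ L * α ^ 2 * M := by positivity
    have h2 := mul_le_mul_of_nonneg_left hN1 h1
    have h3 : (A * εg ^ 2 + L * M) / p * α ^ 2 * N * q ≤ (A * εg ^ 2 + L * M) / p * α ^ 2 * N * p := by
      have e : (A * εg ^ 2 + L * M) / p * α ^ 2 * N * p = (A * εg ^ 2 + L * M) * α ^ 2 * N := by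
        field_simp
      rw [e]
      linarith
    exact le_of_mul_le_mul_left h3 (by positivity)
  -- Covering the whole space and using subadditivity avoids proving that the target event is
  -- measurable.
  have hcover := measureReal_mono (μ := P) (s₁ := Set.univ) (s₂ := _ ∪ _) (fun ω _ => ?_)
    (measure_ne_top P _) |>.trans (measureReal_union_le
      {ω | ∀ k, 0 < k → k ≤ N → noisyGD Ψ α (fun j i => ν j i ω) k ∉ S}
      {ω | ∃ k : ℕ, 0 < k ∧ k ≤ N ∧ ‖gradient Ψ (noisyGD Ψ α (fun j i => ν j i ω) k)‖ ≤ εg ∧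
          -δ ≤ lambdaMin (hessian Ψ (noisyGD Ψ α (fun j i => ν j i ω) k))})
  · rw [probReal_univ] at hcover
    linarith
  · by_cases h : ∀ k, 0 < k → k ≤ N → noisyGD Ψ α (fun j i => ν j i ω) k ∉ S
    · exact Or.inl h
    · push Not at h
      obtain ⟨k, hk0, hkN, hkS⟩ := h
      exact Or.inr ⟨k, hk0, hkN, hkS.1, neg_le_lambdaMin hδ0 hkS.2⟩
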